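/- Let $L_2$ be the two-sorted language of second-order arithmetic, with number variables, set variables, the symbols $0,1,+,\cdot,\le$ on numbers, and $\in$ between numbers and sets. A formula is $\Sigma^0_n$ if it consists of $n$ alternating blocks of number quantifiers, the first existential, in front of a formula with only bounded number quantifiers; free set variables are allowed. Let $\mathsf{RCA}_0$ be the $L_2$-theory axiomatised by (i) the axioms saying that the number sort is the non-negative part of a discretely ordered ring, (ii) $\Delta^0_1$-comprehension: $\forall x\,(\varphi(x)\leftrightarrow\neg\psi(x))\to\exists X\,\forall x\,(x\in X\leftrightarrow\varphi(x))$ for $\Sigma^0_1$ formulas $\varphi,\psi$ with arbitrary number and set parameters, where $X$ does not occur in $\varphi$, and (iii) $\Sigma^0_1\text{-}\mathsf{IND}$, where $\Sigma^0_n\text{-}\mathsf{IND}$ is the scheme $\varphi(0)\wedge\forall x\,(\varphi(x)\to\varphi(x+1))\to\forall x\,\varphi(x)$ for $\Sigma^0_n$ formulas $\varphi$ with arbitrary number and set parameters. Let Bounded-width König's Lemma be the following $L_2$-sentence, where $\mathbb N$ denotes the number sort, finite sets are bounded sets, finite sequences are coded by numbers in the usual way, and infinite sequences are functions on $\mathbb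 N$ given by sets of coded pairs: for every finite set $Q$ and every directed graph $G$ whose vertices belong to $Q\times\mathbb N$ and whose edges are all of the form $((q,i),(q',i+1))$ with $q,q'\in Q$, and for every $q$, if for every $n$ there is a finite path in $G$ of length at least $n$ starting at $(q,0)$, then there is an infinite path in $G$ starting at $(q,0)$. Theorem. $\mathsf{RCA}_0+\Sigma^0_2\text{-}\mathsf{IND}$ implies Bounded-width König's Lemma; that is, Bounded-width König's Lemma is true in every model $(M,\mathcal S)$, $\mathcal S\subseteq\mathcal P(M)$, of $\mathsf{RCA}_0+\Sigma^0_2\text{-}\mathsf{IND}$. -/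

import Mathlib

universe u

namespace SOA

/-! ### The two-sorted language `L₂` of second-order arithmetic

Number variables and set variables are both named by (metatheoretic) natural numbers. -/

/-- Terms of the number sort. -/
inductive Term : Type
  | var (x : ℕ) : Term
  | zero : Term
  | one : Term
  | add (s t : Term) : Term
  | mul (s t : Term) : Term

instance : Zero Term := ⟨Term.zero⟩
instance : One Term := ⟨Term.one⟩
instance : Add Term := ⟨Term.add⟩
instance : Mul Term := ⟨Term.mul⟩

/-- Formulas of `L₂`. `mem t X` says that the number `t` belongs to the set variable `X`;
`all`, `ex` quantify over numbers and `allS`, `exS` quantify over sets. -/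
inductive Formula : Type
  | eq (s t : Term) : Formula
  | le (s t : Term) : Formula
  | mem (t : Term) (X : ℕ) : Formula
  | neg (φ : Formula) : Formula
  | and (φ ψ : Formula) : Formula
  | or (φ ψ : Formula) : Formula
  | imp (φ ψ : Formula) : Formula
  | all (x : ℕ) (φ : Formula) : Formula
  | ex (x : ℕ) (φ : Formula) : Formula
  | allS (X : ℕ) (φ : Formula) : Formula
  | exS (X : ℕ) (φ : Formula) : Formula

infix:60 " ≐ " => Formula.eq
infix:60 " ≼ " => Formula.le
infix:60 " ∈' " => Formula.mem
infixr:45 " ⋏ " => Formula.and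
infixr:42 " ⋎ " => Formula.or
infixr:40 " ⇒' " => Formula.imp

/-- Biconditional. -/
def Formula.iff (φ ψ : Formula) : Formula := (φ ⇒' ψ) ⋏ (ψ ⇒' φ)

/-- Strict order, `s ≤ t` and `s ≠ t`. -/
def Formula.lt (s t : Term) : Formula := s ≼ t ⋏ .neg (s ≐ t)

infix:60 " ≺ " => Formula.lt

/-- The variables of a term. -/
def Term.vars : Term → Finset ℕ
  | .var x => {x}
  | .zero => ∅
  | .one => ∅
  | .add s t => s.vars ∪ t.vars
  | .mul s t => s.vars ∪ t.vars

/-- All number variables (free or bound) occurring in a formula. -/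
def Formula.numVars : Formula → Finset ℕ
  | .eq s t => s.vars ∪ t.vars
  | .le s t => s.vars ∪ t.vars
  | .mem t _ => t.vars
  | .neg φ => φ.numVars
  | .and φ ψ => φ.numVars ∪ ψ.numVars
  | .or φ ψ => φ.numVars ∪ ψ.numVars
  | .imp φ ψ => φ.numVars ∪ ψ.numVars
  | .all x φ => insert x φ.numVars
  | .ex x φ => insert x φ.numVars
  | .allS _ φ => φ.numVars
  | .exS _ φ => φ.numVars

/-- All set variables (free or bound) occurring in a formula. -/
def Formula.setVars : Formula → Finset ℕ
  | .eq _ _ => ∅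
  | .le _ _ => ∅
  | .mem _ X => {X}
  | .neg φ => φ.setVars
  | .and φ ψ => φ.setVars ∪ ψ.setVars
  | .or φ ψ => φ.setVars ∪ ψ.setVars
  | .imp φ ψ => φ.setVars ∪ ψ.setVars
  | .all _ φ => φ.setVars
  | .ex _ φ => φ.setVars
  | .allS X φ => insert X φ.setVars
  | .exS X φ => insert X φ.setVars

/-! ### Structures and truth -/

/-- An `L₂`-structure `(M, 𝒮)`: a first-order structure `M` for `0, 1, +, ·, ≤` together with a
nonempty family `𝒮` of subsets of `M`, over which the set variables range. -/
structure L2Structure : Type (u + 1) where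
  carrier : Type u
  zero : carrier
  one : carrier
  add : carrier → carrier → carrier
  mul : carrier → carrier → carrier
  le : carrier → carrier → Prop
  sets : Set (Set carrier)
  sets_nonempty : sets.Nonempty

/-- Value of a term under an assignment of the number variables. -/
def L2Structure.eval (M : L2Structure.{u}) (e : ℕ → M.carrier) : Term → M.carrier
  | .var x => e x
  | .zero => M.zero
  | .one => M.one
  | .add s t => M.add (M.eval e s) (M.eval e t)
  | .mul s t => M.mul (M.eval e s) (M.eval e t)

/-- Tarski's truth definition: `e` assigns numbers, `E` assigns sets of the structure. -/
def L2Structure.Realize (M : L2Structure.{u}) :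
    Formula → (ℕ → M.carrier) → (ℕ → M.sets) → Prop
  | .eq s t, e, _ => M.eval e s = M.eval e t
  | .le s t, e, _ => M.le (M.eval e s) (M.eval e t)
  | .mem t X, e, E => M.eval e t ∈ (E X : Set M.carrier)
  | .neg φ, e, E => ¬ M.Realize φ e E
  | .and φ ψ, e, E => M.Realize φ e E ∧ M.Realize ψ e E
  | .or φ ψ, e, E => M.Realize φ e E ∨ M.Realize ψ e E
  | .imp φ ψ, e, E => M.Realize φ e E → M.Realize ψ e E
  | .all x φ, e, E => ∀ a : M.carrier, M.Realize φ (Function.update e x a) E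
  | .ex x φ, e, E => ∃ a : M.carrier, M.Realize φ (Function.update e x a) E
  | .allS X φ, e, E => ∀ A : M.sets, M.Realize φ e (Function.update E X A)
  | .exS X φ, e, E => ∃ A : M.sets, M.Realize φ e (Function.update E X A)

/-- A formula holds in `M` if it is true under all assignments (so its free variables, the
parameters, are read as universally quantified). -/
def L2Structure.Holds (M : L2Structure.{u}) (φ : Formula) : Prop :=
  ∀ (e : ℕ → M.carrier) (E : ℕ → M.sets), M.Realize φ e E

/-- `T` logically implies `φ`: `φ` holds in every model of `T`. -/
def Entails (T : Set Formula) (φ : Formula) : Prop :=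
  ∀ M : L2Structure.{u}, (∀ τ ∈ T, M.Holds τ) → M.Holds φ

/-! ### Quantifier hierarchy -/

/-- `Δ⁰₀` formulas: only bounded number quantifiers `∀ x ≤ t`, `∃ x ≤ t` (with `x` not in `t`)
and no set quantifiers; set variables may occur free. -/
inductive IsDelta0 : Formula → Prop
  | eq (s t : Term) : IsDelta0 (s ≐ t)
  | le (s t : Term) : IsDelta0 (s ≼ t)
  | mem (t : Term) (X : ℕ) : IsDelta0 (t ∈' X)
  | neg {φ : Formula} : IsDelta0 φ → IsDelta0 (.neg φ)
  | and {φ ψ : Formula} : IsDelta0 φ → IsDelta0 ψ → IsDelta0 (φ ⋏ ψ)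
  | or {φ ψ : Formula} : IsDelta0 φ → IsDelta0 ψ → IsDelta0 (φ ⋎ ψ)
  | imp {φ ψ : Formula} : IsDelta0 φ → IsDelta0 ψ → IsDelta0 (φ ⇒' ψ)
  | ball {x : ℕ} {t : Term} {φ : Formula} :
      x ∉ t.vars → IsDelta0 φ → IsDelta0 (.all x (.var x ≼ t ⇒' φ))
  | bex {x : ℕ} {t : Term} {φ : Formula} :
      x ∉ t.vars → IsDelta0 φ → IsDelta0 (.ex x (.var x ≼ t ⋏ φ))

mutual
/-- `Σ⁰ₙ` formulas: `n` alternating blocks of number quantifiers, starting with `∃`, in front of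
a `Δ⁰₀` formula. -/
inductive IsSigma : ℕ → Formula → Prop
  | delta0 {φ : Formula} : IsDelta0 φ → IsSigma 0 φ
  | of_pi {n : ℕ} {φ : Formula} : IsPi n φ → IsSigma (n + 1) φ
  | ex {n : ℕ} {φ : Formula} (x : ℕ) : IsSigma (n + 1) φ → IsSigma (n + 1) (.ex x φ)
/-- `Π⁰ₙ` formulas: the same, starting with `∀`. -/
inductive IsPi : ℕ → Formula → Prop
  | delta0 {φ : Formula} : IsDelta0 φ → IsPi 0 φ
  | of_sigma {n : ℕ} {φ : Formula} : IsSigma n φ → IsPi (n + 1) φ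
  | all {n : ℕ} {φ : Formula} (x : ℕ) : IsPi (n + 1) φ → IsPi (n + 1) (.all x φ)
end

/-! ### Axioms -/

section
open Term (var)

/-- The number sort is the non-negative part of a discretely ordered ring. -/
def basicAxioms : Set Formula :=
  { (var 0 + var 1) + var 2 ≐ var 0 + (var 1 + var 2),
    var 0 + var 1 ≐ var 1 + var 0,
    (var 0 * var 1) * var 2 ≐ var 0 * (var 1 * var 2),
    var 0 * var 1 ≐ var 1 * var 0,
    var 0 * (var 1 + var 2) ≐ var 0 * var 1 + var 0 * var 2,
    var 0 + 0 ≐ var 0,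
    var 0 * 0 ≐ 0,
    var 0 * 1 ≐ var 0,
    var 0 ≼ var 0,
    var 0 ≼ var 1 ⋏ var 1 ≼ var 0 ⇒' var 0 ≐ var 1,
    var 0 ≼ var 1 ⋏ var 1 ≼ var 2 ⇒' var 0 ≼ var 2,
    var 0 ≼ var 1 ⋎ var 1 ≼ var 0,
    var 0 ≺ var 1 ⇒' var 0 + var 2 ≺ var 1 + var 2,
    0 ≺ var 2 ⋏ var 0 ≺ var 1 ⇒' var 0 * var 2 ≺ var 1 * var 2,
    var 0 ≼ var 1 ⇒' .ex 2 (var 0 + var 2 ≐ var 1),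
    0 ≼ var 0,
    0 ≺ 1,
    0 ≺ var 0 ⇒' 1 ≼ var 0 }

/-- The induction axiom for `φ` in the variable `x`:
`φ(0) ∧ ∀ x (φ(x) → φ(x + 1)) → ∀ x φ(x)`.
Here `φ(0)` is written `∀ x (x = 0 → φ)`, and `φ(x + 1)` is written
`∀ y (y = x + 1 → ∀ x (x = y → φ))` with `y` a variable that does not occur in `φ`. -/
def inductionAxiom (x y : ℕ) (φ : Formula) : Formula :=
  .all x (var x ≐ 0 ⇒' φ) ⋏
    .all x (φ ⇒' .all y (var y ≐ var x + 1 ⇒' .all x (var x ≐ var y ⇒' φ)))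
  ⇒' .all x φ

/-- The scheme `Σ⁰ₙ-IND` (with arbitrary number and set parameters). -/
def sigmaInd (n : ℕ) : Set Formula :=
  { θ | ∃ (φ : Formula) (x y : ℕ), IsSigma n φ ∧ y ≠ x ∧ y ∉ φ.numVars ∧
      θ = inductionAxiom x y φ }

/-- The scheme of `Δ⁰₁`-comprehension:
`∀ x (φ(x) ↔ ¬ ψ(x)) → ∃ X ∀ x (x ∈ X ↔ φ(x))` for `φ, ψ` in `Σ⁰₁`, `X` not in `φ`. -/
def delta1Comprehension : Set Formula :=
  { θ | ∃ (φ ψ : Formula) (x X : ℕ), IsSigma 1 φ ∧ IsSigma 1 ψ ∧ X ∉ φ.setVars ∧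
      θ = (.all x (φ.iff (.neg ψ)) ⇒' .exS X (.all x ((var x ∈' X).iff φ))) }

/-- The theory `RCA₀`. -/
def RCA0 : Set Formula := basicAxioms ∪ delta1Comprehension ∪ sigmaInd 1

/-! ### Bounded-width König's Lemma as an `L₂`-sentence

Pairs are coded by `(s, t) = (s + t)² + s`. A finite set is a bounded set. A finite sequence of
numbers is coded by a pair of numbers through Gödel's β-function. An infinite sequence is a set
of pairs that is the graph of a function. -/

/-- The pair `(s, t)`. -/
def pair (s t : Term) : Term := (s + t) * (s + t) + s

/-- `v` is the `i`-th entry of the sequence coded by `c, d`, that is, `v` is the remainder of `c`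
modulo `1 + (i + 1) d`. The bound variable `k` must not occur in the terms. -/
def entry (k : ℕ) (c d i v : Term) : Formula :=
  v ≺ 1 + (i + 1) * d ⋏ .ex k (c ≐ var k * (1 + (i + 1) * d) + v)

/-- The set `Q` is finite. -/
def finiteSet (Q : ℕ) : Formula :=
  .ex 0 (.all 1 (var 1 ∈' Q ⇒' var 1 ≼ var 0))

/-- `V` and `E` are the vertex set and the edge set of a directed graph whose vertices belong to
`Q × ℕ` and whose edges are all of the form `((q, i), (q', i + 1))`. -/
def levelGraph (Q V E : ℕ) : Formula :=
  .all 0 (var 0 ∈' V ⇒' .ex 1 (.ex 2 (var 1 ∈' Q ⋏ var 0 ≐ pair (var 1) (var 2)))) ⋏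
  .all 0 (var 0 ∈' E ⇒' .ex 1 (.ex 2 (.ex 3
    (pair (var 1) (var 3) ∈' V ⋏ pair (var 2) (var 3 + 1) ∈' V ⋏
      var 0 ≐ pair (pair (var 1) (var 3)) (pair (var 2) (var 3 + 1))))))

/-- There are arbitrarily long finite paths from `(q, 0)`, where `q` is the number variable `0`:
for every `n` (variable `1`) there are `m ≥ n` (variable `2`) and a sequence with code `c, d`
(variables `3, 4`) whose entries with indices `0, …, m` form a path starting at `(q, 0)`. -/
def longPaths (V E : ℕ) : Formula :=
  .all 1 (.ex 2 (.ex 3 (.ex 4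
    (var 1 ≼ var 2 ⋏
     pair (var 0) 0 ∈' V ⋏
     entry 8 (var 3) (var 4) 0 (pair (var 0) 0) ⋏
     .all 5 (var 5 ≺ var 2 ⇒' .ex 6 (.ex 7
       (entry 8 (var 3) (var 4) (var 5) (var 6) ⋏
        entry 8 (var 3) (var 4) (var 5 + 1) (var 7) ⋏
        pair (var 6) (var 7) ∈' E)))))))

/-- `P` is (the graph of) a function from `ℕ` to `ℕ`. -/
def isFunction (P : ℕ) : Formula :=
  .all 1 (var 1 ∈' P ⇒' .ex 2 (.ex 3 (var 1 ≐ pair (var 2) (var 3)))) ⋏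
  .all 1 (.ex 2 (pair (var 1) (var 2) ∈' P)) ⋏
  .all 1 (.all 2 (.all 3
    (pair (var 1) (var 2) ∈' P ⋏ pair (var 1) (var 3) ∈' P ⇒' var 2 ≐ var 3)))

/-- `P` is an infinite path `v₀, v₁, …` with `v₀ = (q, 0)`, where `q` is the number
variable `0`. -/
def infinitePath (E P : ℕ) : Formula :=
  isFunction P ⋏
  pair 0 (pair (var 0) 0) ∈' P ⋏
  .all 1 (.all 2 (.all 3
    (pair (var 1) (var 2) ∈' P ⋏ pair (var 1 + 1) (var 3) ∈' P ⇒'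
      pair (var 2) (var 3) ∈' E)))

/-- Bounded-width König's Lemma, with set variables `Q = 0`, `V = 1`, `E = 2`, `P = 3`. -/
def boundedWidthKonig : Formula :=
  .allS 0 (.allS 1 (.allS 2
    (finiteSet 0 ⋏ levelGraph 0 1 2 ⇒'
      .all 0 (longPaths 1 2 ⇒' .exS 3 (infinitePath 2 3)))))

end

end SOA

/-!
A vertex is extendible if paths from it lead to all later levels; a recursion that always moves to
an extendible vertex yields the infinite path, provided that extendibility is `Δ⁰₁`. For a level
`i` and a level `n ≥ i`, the set of the vertices at level `i` from which level `n` is reached is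
coded by the least common multiple of Gödel moduli attached to its elements. These sets shrink as
`n` grows, and their codes shrink with them. By `Σ⁰₂` induction the codes have a limit inferior
`m`: from some level on no code is smaller than `m`, while `m` is attained at arbitrarily high
levels. A set coded by `m` at such a level `i` cannot shrink any further, so a vertex at a level
`j ≤ i` is extendible as soon as paths from it lead to the level `n` at which `m` is attained.
-/

namespace SOA

section Definability

variable {M : Type u}

/-- Polynomial functions of `n` variables, with coefficients in `M`. This and the following
classes are classes so that instance search proves definability from the shape of a relation. -/
class inductive PolyFun [Add M] [Mul M] : {n : ℕ} → ((Fin n → M) → M) → Prop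
  | var {n : ℕ} (i : Fin n) : PolyFun fun v => v i
  | const {n : ℕ} (c : M) : PolyFun fun _ : Fin n → M => c
  | add {n : ℕ} {f g : (Fin n → M) → M} (hf : PolyFun f) (hg : PolyFun g) :
      PolyFun fun v => f v + g v
  | mul {n : ℕ} {f g : (Fin n → M) → M} (hf : PolyFun f) (hg : PolyFun g) :
      PolyFun fun v => f v * g v

/-- `Δ⁰₀` relations, with number parameters from `M` and set parameters from `S`. The bound
variable of a quantifier becomes the last variable of the relation it binds. -/
class inductive Delta0Rel [Add M] [Mul M] [LE M] (S : Set (Set M)) :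
    {n : ℕ} → ((Fin n → M) → Prop) → Prop
  | eq {n : ℕ} {f g : (Fin n → M) → M} (hf : PolyFun f) (hg : PolyFun g) :
      Delta0Rel S fun v => f v = g v
  | le {n : ℕ} {f g : (Fin n → M) → M} (hf : PolyFun f) (hg : PolyFun g) :
      Delta0Rel S fun v => f v ≤ g v
  | mem {n : ℕ} {f : (Fin n → M) → M} (X : S) (hf : PolyFun f) :
      Delta0Rel S fun v => f v ∈ (X : Set M)
  | not {n : ℕ} {P : (Fin n → M) → Prop} (hP : Delta0Rel S P) : Delta0Rel S fun v => ¬ P v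
  | and {n : ℕ} {P Q : (Fin n → M) → Prop} (hP : Delta0Rel S P) (hQ : Delta0Rel S Q) :
      Delta0Rel S fun v => P v ∧ Q v
  | or {n : ℕ} {P Q : (Fin n → M) → Prop} (hP : Delta0Rel S P) (hQ : Delta0Rel S Q) :
      Delta0Rel S fun v => P v ∨ Q v
  | imp {n : ℕ} {P Q : (Fin n → M) → Prop} (hP : Delta0Rel S P) (hQ : Delta0Rel S Q) :
      Delta0Rel S fun v => P v → Q v
  | ball {n : ℕ} {t : (Fin n → M) → M} {P : (Fin n → M) → M → Prop} (ht : PolyFun t)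
      (hP : Delta0Rel S fun w : Fin (n + 1) → M => P (fun i => w i.castSucc) (w (Fin.last n))) :
      Delta0Rel S fun v => ∀ a ≤ t v, P v a
  | bex {n : ℕ} {t : (Fin n → M) → M} {P : (Fin n → M) → M → Prop} (ht : PolyFun t)
      (hP : Delta0Rel S fun w : Fin (n + 1) → M => P (fun i => w i.castSucc) (w (Fin.last n))) :
      Delta0Rel S fun v => ∃ a ≤ t v, P v a

/-- `Σ⁰₁` relations with parameters. -/
class inductive Sigma1Rel [Add M] [Mul M] [LE M] (S : Set (Set M)) :
    {n : ℕ} → ((Fin n → M) → Prop) → Prop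
  | delta0 {n : ℕ} {P : (Fin n → M) → Prop} (hP : Delta0Rel S P) : Sigma1Rel S P
  | ex {n : ℕ} {P : (Fin n → M) → M → Prop}
      (hP : Sigma1Rel S fun w : Fin (n + 1) → M => P (fun i => w i.castSucc) (w (Fin.last n))) :
      Sigma1Rel S fun v => ∃ a, P v a

/-- `Π⁰₁` relations with parameters. -/
class inductive Pi1Rel [Add M] [Mul M] [LE M] (S : Set (Set M)) :
    {n : ℕ} → ((Fin n → M) → Prop) → Prop
  | delta0 {n : ℕ} {P : (Fin n → M) → Prop} (hP : Delta0Rel S P) : Pi1Rel S P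
  | all {n : ℕ} {P : (Fin n → M) → M → Prop}
      (hP : Pi1Rel S fun w : Fin (n + 1) → M => P (fun i => w i.castSucc) (w (Fin.last n))) :
      Pi1Rel S fun v => ∀ a, P v a

/-- `Σ⁰₂` relations with parameters. -/
class inductive Sigma2Rel [Add M] [Mul M] [LE M] (S : Set (Set M)) :
    {n : ℕ} → ((Fin n → M) → Prop) → Prop
  | pi1 {n : ℕ} {P : (Fin n → M) → Prop} (hP : Pi1Rel S P) : Sigma2Rel S P
  | ex {n : ℕ} {P : (Fin n → M) → M → Prop}
      (hP : Sigma2Rel S fun w : Fin (n + 1) → M => P (fun i => w i.castSucc) (w (Fin.last n))) :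
      Sigma2Rel S fun v => ∃ a, P v a

variable [Add M] [Mul M] {n m : ℕ} {f g t : (Fin n → M) → M}

attribute [instance] PolyFun.var PolyFun.const

instance [hf : PolyFun f] [hg : PolyFun g] : PolyFun fun v => f v + g v := .add hf hg

instance [hf : PolyFun f] [hg : PolyFun g] : PolyFun fun v => f v * g v := .mul hf hg

theorem PolyFun.comp (hf : PolyFun f) {σ : Fin n → (Fin m → M) → M} (hσ : ∀ i, PolyFun (σ i)) :
    PolyFun fun w => f fun i => σ i w := by
  induction hf with
  | var i => exact hσ i
  | const c => exact .const c
  | add _ _ ihf ihg => exact .add ihf ihg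
  | mul _ _ ihf ihg => exact .mul ihf ihg

theorem PolyFun.snoc {σ : Fin n → (Fin m → M) → M} (hσ : ∀ i, PolyFun (σ i)) (j : Fin (n + 1)) :
    PolyFun fun w : Fin (m + 1) → M =>
      (Fin.snoc (fun i => σ i fun k => w k.castSucc) (w (Fin.last m)) : Fin (n + 1) → M) j := by
  cases j using Fin.lastCases with
  | last => simpa only [Fin.snoc_last] using .var _
  | cast i => simpa only [Fin.snoc_castSucc] using (hσ i).comp fun k => .var k.castSucc

instance [hf : PolyFun f] (σ : Fin n → Fin m) : PolyFun fun w => f fun i => w (σ i) :=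
  hf.comp fun i => .var (σ i)

variable [LE M] {S : Set (Set M)} {P Q : (Fin n → M) → Prop} {R : (Fin n → M) → M → Prop}

instance [hf : PolyFun f] [hg : PolyFun g] : Delta0Rel S fun v => f v = g v := .eq hf hg

instance [hf : PolyFun f] [hg : PolyFun g] : Delta0Rel S fun v => f v ≤ g v := .le hf hg

instance (X : S) [hf : PolyFun f] : Delta0Rel S fun v => f v ∈ (X : Set M) := .mem X hf

instance [hP : Delta0Rel S P] : Delta0Rel S fun v => ¬ P v := .not hP

instance [hP : Delta0Rel S P] [hQ : Delta0Rel S Q] : Delta0Rel S fun v => P v ∧ Q v := .and hP hQ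

instance [hP : Delta0Rel S P] [hQ : Delta0Rel S Q] : Delta0Rel S fun v => P v ∨ Q v := .or hP hQ

instance [hP : Delta0Rel S P] [hQ : Delta0Rel S Q] : Delta0Rel S fun v => P v → Q v := .imp hP hQ

instance [hP : Delta0Rel S P] [hQ : Delta0Rel S Q] : Delta0Rel S fun v => P v ↔ Q v := by
  simpa only [iff_iff_implies_and_implies] using .and (.imp hP hQ) (.imp hQ hP)

instance [ht : PolyFun t]
    [hR : Delta0Rel S fun w : Fin (n + 1) → M => R (fun i => w i.castSucc) (w (Fin.last n))] :
    Delta0Rel S fun v => ∀ a ≤ t v, R v a := .ball ht hR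

instance [ht : PolyFun t]
    [hR : Delta0Rel S fun w : Fin (n + 1) → M => R (fun i => w i.castSucc) (w (Fin.last n))] :
    Delta0Rel S fun v => ∃ a ≤ t v, R v a := .bex ht hR

instance [hP : Delta0Rel S P] : Sigma1Rel S P := .delta0 hP

instance [hR : Sigma1Rel S fun w : Fin (n + 1) → M =>
      R (fun i => w i.castSucc) (w (Fin.last n))] :
    Sigma1Rel S fun v => ∃ a, R v a := .ex hR

instance [hP : Delta0Rel S P] : Pi1Rel S P := .delta0 hP

instance [hR : Pi1Rel S fun w : Fin (n + 1) → M => R (fun i => w i.castSucc) (w (Fin.last n))] :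
    Pi1Rel S fun v => ∀ a, R v a := .all hR

instance [hP : Pi1Rel S P] : Sigma2Rel S P := .pi1 hP

instance [hR : Sigma2Rel S fun w : Fin (n + 1) → M =>
      R (fun i => w i.castSucc) (w (Fin.last n))] :
    Sigma2Rel S fun v => ∃ a, R v a := .ex hR

theorem Delta0Rel.comp (hP : Delta0Rel S P) {m : ℕ} {σ : Fin n → (Fin m → M) → M}
    (hσ : ∀ i, PolyFun (σ i)) : Delta0Rel S fun w => P fun i => σ i w := by
  induction hP generalizing m with
  | eq hf hg => exact .eq (hf.comp hσ) (hg.comp hσ)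
  | le hf hg => exact .le (hf.comp hσ) (hg.comp hσ)
  | mem X hf => exact .mem X (hf.comp hσ)
  | not _ ih => exact .not (ih hσ)
  | and _ _ ihP ihQ => exact .and (ihP hσ) (ihQ hσ)
  | or _ _ ihP ihQ => exact .or (ihP hσ) (ihQ hσ)
  | imp _ _ ihP ihQ => exact .imp (ihP hσ) (ihQ hσ)
  | ball ht _ ih =>
    exact .ball (ht.comp hσ) (by simpa only [Fin.snoc_castSucc, Fin.snoc_last] using ih (.snoc hσ))
  | bex ht _ ih =>
    exact .bex (ht.comp hσ) (by simpa only [Fin.snoc_castSucc, Fin.snoc_last] using ih (.snoc hσ))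

theorem Sigma1Rel.comp (hP : Sigma1Rel S P) {m : ℕ} {σ : Fin n → (Fin m → M) → M}
    (hσ : ∀ i, PolyFun (σ i)) : Sigma1Rel S fun w => P fun i => σ i w := by
  induction hP generalizing m with
  | delta0 hP => exact .delta0 (hP.comp hσ)
  | ex _ ih => exact .ex (by simpa only [Fin.snoc_castSucc, Fin.snoc_last] using ih (.snoc hσ))

theorem Sigma1Rel.and (hP : Sigma1Rel S P) (hQ : Sigma1Rel S Q) :
    Sigma1Rel S fun v => P v ∧ Q v := by
  induction hP with
  | delta0 hP =>
    induction hQ with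
    | delta0 hQ => exact .delta0 (.and hP hQ)
    | @ex n Q _ ih =>
      simp only [← exists_and_left]
      exact .ex (ih (hP.comp fun i => .var i.castSucc))
  | @ex n P _ ih =>
    simp only [← exists_and_right]
    exact .ex (ih (hQ.comp fun i => .var i.castSucc))

instance [hP : Sigma1Rel S P] [hQ : Sigma1Rel S Q] : Sigma1Rel S fun v => P v ∧ Q v := .and hP hQ

end Definability

section Arithmetic

variable {M : Type u} [CommSemiring M] {n : ℕ} {f g t : (Fin n → M) → M}

/-- The pairing function by which the sentence `boundedWidthKonig` codes pairs. -/
def pairCode (s t : M) : M := (s + t) * (s + t) + s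

local notation "⟪" s ", " t "⟫" => pairCode s t

instance [PolyFun f] [PolyFun g] : PolyFun fun v => ⟪f v, g v⟫ := by
  unfold pairCode
  infer_instance

/-- The moduli of Gödel's β-function. -/
def modulus (d z : M) : M := 1 + (z + 1) * d

instance [PolyFun f] [PolyFun g] : PolyFun fun v => modulus (f v) (g v) := by
  unfold modulus
  infer_instance

variable [LinearOrder M] {S : Set (Set M)}

instance [PolyFun f] [PolyFun g] : Delta0Rel S fun v => f v < g v := by
  simp only [← not_le]
  infer_instance

instance [PolyFun t] {R : (Fin n → M) → M → Prop}
    [Delta0Rel S fun w : Fin (n + 1) → M => R (fun i => w i.castSucc) (w (Fin.last n))] :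
    Delta0Rel S fun v => ∀ a < t v, R v a := by
  have (v : Fin n → M) : (∀ a < t v, R v a) ↔ ∀ a ≤ t v, a < t v → R v a :=
    ⟨fun h a _ => h a, fun h a ha => h a ha.le ha⟩
  simp only [this]
  infer_instance

variable [CanonicallyOrderedAdd M]

theorem left_le_pairCode (s t : M) : s ≤ ⟪s, t⟫ := le_add_self

variable [IsStrictOrderedRing M]

theorem dvd_of_dvd_add {a b c : M} (h : a ∣ b + c) (hb : a ∣ b) : a ∣ c := by
  obtain ⟨u, rfl⟩ := hb
  obtain ⟨v, hv⟩ := h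
  rcases le_total u v with huv | hvu
  · obtain ⟨w, rfl⟩ := exists_add_of_le huv
    exact ⟨w, add_left_cancel (hv.trans (mul_add a u w))⟩
  · obtain ⟨w, rfl⟩ := exists_add_of_le hvu
    rw [mul_add, add_assoc, add_eq_left, add_eq_zero] at hv
    exact hv.2 ▸ dvd_zero a

theorem pairCode_le_pairCode {s t s' t' : M} (hs : s ≤ s') (ht : t ≤ t') :
    ⟪s, t⟫ ≤ ⟪s', t'⟫ := by
  unfold pairCode
  gcongr

theorem one_lt_modulus {d : M} (hd : 0 < d) (z : M) : 1 < modulus d z :=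
  lt_add_of_pos_right 1 (by positivity)

theorem modulus_dvd_of_dvd_mul {d z c t : M} (ht : t ∣ d) (h : modulus d z ∣ c * (t * d)) :
    modulus d z ∣ c := by
  have dvd_of_dvd_mul_self {c : M} (h : modulus d z ∣ c * ((z + 1) * d)) : modulus d z ∣ c :=
    dvd_of_dvd_add (b := c * ((z + 1) * d)) (Dvd.intro_left c (by unfold modulus; ring)) h
  have hct : modulus d z ∣ c * t :=
    dvd_of_dvd_mul_self ((h.mul_right (z + 1)).trans (dvd_of_eq (by ring)))
  obtain ⟨e, rfl⟩ := ht
  exact dvd_of_dvd_mul_self ((hct.mul_right (e * (z + 1))).trans (dvd_of_eq (by ring)))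

/-- Euclid's lemma for the moduli: those with indices at most `N` are pairwise coprime. -/
theorem modulus_dvd_mul_modulus_iff {d N z y c : M} (hd : ∀ t, 0 < t → t ≤ N → t ∣ d)
    (hz : z ≤ N) (hy : y ≤ N) (hzy : z ≠ y) :
    modulus d z ∣ c * modulus d y ↔ modulus d z ∣ c := by
  refine ⟨fun h => ?_, fun h => h.mul_right _⟩
  rcases lt_or_gt_of_ne hzy with hlt | hlt <;>
    obtain ⟨t, ht, rfl⟩ := exists_pos_add_of_lt' hlt
  · refine modulus_dvd_of_dvd_mul (hd t ht (le_add_self.trans hy))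
      (dvd_of_dvd_add (b := c * modulus d z) ?_ (dvd_mul_left _ _))
    exact h.trans (dvd_of_eq (by unfold modulus; ring))
  · refine modulus_dvd_of_dvd_mul (hd t ht (le_add_self.trans hz))
      (dvd_of_dvd_add (b := c * modulus d y) ?_ h)
    exact Dvd.intro_left c (by unfold modulus; ring)

variable [SuccAddOrder M]

theorem dvd_iff_exists_le {a b : M} : a ∣ b ↔ ∃ k ≤ b, b = a * k := by
  refine ⟨?_, fun ⟨k, _, hk⟩ => ⟨k, hk⟩⟩
  rintro ⟨k, rfl⟩
  rcases eq_zero_or_pos a with rfl | ha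
  · exact ⟨0, by simp⟩
  · exact ⟨k, le_mul_of_one_le_left zero_le (Order.one_le_iff_pos.2 ha), rfl⟩

theorem le_of_dvd {a b : M} (h : a ∣ b) (hb : 0 < b) : a ≤ b := by
  obtain ⟨k, rfl⟩ := h
  exact le_mul_of_one_le_right zero_le (Order.one_le_iff_pos.2 (pos_of_mul_pos_right hb zero_le))

instance [PolyFun f] [PolyFun g] : Delta0Rel S fun v => f v ∣ g v := by
  simp only [dvd_iff_exists_le]
  infer_instance

theorem pairCode_lt_of_add_lt {s t s' t' : M} (h : s + t < s' + t') : ⟪s, t⟫ < ⟪s', t'⟫ :=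
  calc (s + t) * (s + t) + s ≤ (s + t) * (s + t) + (s + t) + (s + t) :=
        add_le_add le_self_add le_self_add |>.trans' (by simp)
    _ < (s + t) * (s + t) + (s + t) + (s + t) + 1 := lt_add_one _
    _ = (s + t + 1) * (s + t + 1) := by ring
    _ ≤ (s' + t') * (s' + t') :=
        mul_self_le_mul_self zero_le (Order.add_one_le_of_lt h)
    _ ≤ (s' + t') * (s' + t') + s' := le_self_add

@[simp]
theorem pairCode_inj {s t s' t' : M} : ⟪s, t⟫ = ⟪s', t'⟫ ↔ s = s' ∧ t = t' := by
  refine ⟨fun h => ?_, fun ⟨hs, ht⟩ => by rw [hs, ht]⟩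
  have hadd : s + t = s' + t' := by
    by_contra hne
    rcases lt_or_gt_of_ne hne with hlt | hlt
    · exact (pairCode_lt_of_add_lt hlt).ne h
    · exact (pairCode_lt_of_add_lt hlt).ne' h
  unfold pairCode at h
  rw [hadd] at h
  obtain rfl := add_left_cancel h
  exact ⟨rfl, add_left_cancel hadd⟩

theorem right_le_pairCode (s t : M) : t ≤ ⟪s, t⟫ := by
  have le_mul_self : s + t ≤ (s + t) * (s + t) := by
    rcases eq_zero_or_pos (s + t) with h | h
    · rw [h, zero_mul]
    · exact le_mul_of_one_le_left zero_le (Order.one_le_iff_pos.2 h)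
  exact le_add_self.trans (le_mul_self.trans le_self_add)

end Arithmetic

local notation "⟪" s ", " t "⟫" => pairCode s t

section Models

variable {M : Type u} [CommSemiring M]

theorem PolyFun.comp₁ {f : M → M} (hf : PolyFun fun v : Fin 1 → M => f (v 0)) {n : ℕ}
    (g : (Fin n → M) → M) [hg : PolyFun g] : PolyFun fun w => f (g w) :=
  hf.comp (σ := fun _ => g) fun _ => hg

variable [LinearOrder M]

/-- The semantic form of `RCA₀` over an ordered semiring `M`, for a family `S` of subsets of `M`:
comprehension for relations that are `Δ⁰₁` in parameters, and `Σ⁰₁` induction. -/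
structure ModelsRCA0 (S : Set (Set M)) : Prop where
  comprehension (P Q : M → Prop) [Sigma1Rel S fun v : Fin 1 → M => P (v 0)]
    [Sigma1Rel S fun v : Fin 1 → M => Q (v 0)] (h : ∀ x, P x ↔ ¬ Q x) :
    ∃ X : S, ∀ x, x ∈ (X : Set M) ↔ P x
  induction (P : M → Prop) [Sigma1Rel S fun v : Fin 1 → M => P (v 0)] (zero : P 0)
    (succ : ∀ x, P x → P (x + 1)) (x : M) : P x

/-- The semantic form of `RCA₀ + Σ⁰₂-IND`. -/
structure ModelsSigma2Ind (S : Set (Set M)) : Prop extends ModelsRCA0 S where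
  sigma2_induction (P : M → Prop) [Sigma2Rel S fun v : Fin 1 → M => P (v 0)] (zero : P 0)
    (succ : ∀ x, P x → P (x + 1)) (x : M) : P x

variable {S : Set (Set M)}

theorem Delta0Rel.comp₃ {R : M → M → M → Prop}
    (hR : Delta0Rel S fun v : Fin 3 → M => R (v 0) (v 1) (v 2))
    {n : ℕ} (f g h : (Fin n → M) → M) [hf : PolyFun f] [hg : PolyFun g] [hh : PolyFun h] :
    Delta0Rel S fun w => R (f w) (g w) (h w) :=
  hR.comp (σ := ![f, g, h]) (by simp [Fin.forall_fin_succ, hf, hg, hh])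

theorem Sigma1Rel.comp₁ {P : M → Prop} (hP : Sigma1Rel S fun v : Fin 1 → M => P (v 0)) {n : ℕ}
    (f : (Fin n → M) → M) [hf : PolyFun f] : Sigma1Rel S fun w => P (f w) :=
  hP.comp (σ := fun _ => f) fun _ => hf

theorem Sigma1Rel.comp₂ {R : M → M → Prop} (hR : Sigma1Rel S fun v : Fin 2 → M => R (v 0) (v 1))
    {n : ℕ} (f g : (Fin n → M) → M) [hf : PolyFun f] [hg : PolyFun g] :
    Sigma1Rel S fun w => R (f w) (g w) :=
  hR.comp (σ := ![f, g]) (Fin.forall_fin_two.2 ⟨hf, hg⟩)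

theorem Sigma1Rel.comp₃ {R : M → M → M → Prop}
    (hR : Sigma1Rel S fun v : Fin 3 → M => R (v 0) (v 1) (v 2))
    {n : ℕ} (f g h : (Fin n → M) → M) [hf : PolyFun f] [hg : PolyFun g] [hh : PolyFun h] :
    Sigma1Rel S fun w => R (f w) (g w) (h w) :=
  hR.comp (σ := ![f, g, h]) (by simp [Fin.forall_fin_succ, hf, hg, hh])

namespace ModelsRCA0

theorem exists_set (hM : ModelsRCA0 S) (P : M → Prop)
    [Delta0Rel S fun v : Fin 1 → M => P (v 0)] : ∃ X : S, ∀ x, x ∈ (X : Set M) ↔ P x :=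
  hM.comprehension P (fun x => ¬ P x) fun _ => not_not.symm

variable [SuccAddOrder M]

theorem exists_div (hM : ModelsRCA0 S) (a : M) {b : M} (hb : 0 < b) :
    ∃ k, ∃ r < b, a = b * k + r := by
  suffices ∃ k r, r < b ∧ a = b * k + r from this
  refine hM.induction (fun a => ∃ k r, r < b ∧ a = b * k + r) ?_ ?_ a
  · exact ⟨0, 0, hb, by simp⟩
  · rintro _ ⟨k, r, hr, rfl⟩
    rcases (Order.add_one_le_of_lt hr).lt_or_eq with hlt | heq
    · exact ⟨k, r + 1, hlt, add_assoc _ _ _⟩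
    · exact ⟨k + 1, 0, hb, by rw [add_assoc, heq, mul_add_one, add_zero]⟩

variable [CanonicallyOrderedAdd M] [IsStrictOrderedRing M]

theorem exists_least (hM : ModelsRCA0 S) (X : S) (hX : (X : Set M).Nonempty) :
    ∃ x ∈ (X : Set M), ∀ y < x, y ∉ (X : Set M) := by
  by_contra! hleast
  obtain ⟨x, hx⟩ := hX
  have not_mem_of_lt : ∀ x, ∀ y < x, y ∉ (X : Set M) := by
    refine hM.induction _ (fun y hy => absurd hy not_lt_zero) fun x ih y hy hyX => ?_
    obtain ⟨z, hz, hzX⟩ := hleast y hyX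
    exact ih z (hz.trans_le (Order.lt_add_one_iff.1 hy)) hzX
  exact not_mem_of_lt (x + 1) x (lt_add_one x) hx

theorem exists_common_multiple (hM : ModelsRCA0 S) {f : M → M}
    [hf : PolyFun fun v : Fin 1 → M => f (v 0)] (hpos : ∀ z, 0 < f z) (N : M) :
    ∃ m > 0, ∀ z ≤ N, f z ∣ m := by
  have {n : ℕ} (g : (Fin n → M) → M) [PolyFun g] : PolyFun fun w => f (g w) := hf.comp₁ g
  suffices ∃ m, 0 < m ∧ ∀ z ≤ N, f z ∣ m from this
  refine hM.induction (fun N => ∃ m, 0 < m ∧ ∀ z ≤ N, f z ∣ m) ?_ ?_ N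
  · exact ⟨f 0, hpos 0, fun z hz => by rw [nonpos_iff_eq_zero.1 hz]⟩
  · rintro N ⟨m, hm, hdvd⟩
    refine ⟨m * f (N + 1), mul_pos hm (hpos _), fun z hz => ?_⟩
    rcases hz.lt_or_eq with hlt | rfl
    · exact (hdvd z (Order.lt_add_one_iff.1 hlt)).mul_right _
    · exact dvd_mul_left _ _

theorem dvd_of_least_common_multiple (hM : ModelsRCA0 S) {A : Set M} {m c : M} (hm : 0 < m)
    (hmA : ∀ a ∈ A, a ∣ m) (hleast : ∀ y < m, 0 < y → ∃ a ∈ A, ¬ a ∣ y)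
    (hcA : ∀ a ∈ A, a ∣ c) : m ∣ c := by
  obtain ⟨k, r, hr, rfl⟩ := hM.exists_div c hm
  suffices r = 0 by simp [this]
  by_contra hr0
  obtain ⟨a, ha, har⟩ := hleast r hr (pos_iff_ne_zero.2 hr0)
  exact har (dvd_of_dvd_add (hcA a ha) ((hmA a ha).mul_right k))

theorem exists_pos_forall_le_dvd (hM : ModelsRCA0 S) (N : M) :
    ∃ d > 0, ∀ t, 0 < t → t ≤ N → t ∣ d := by
  obtain ⟨d, hd, hdvd⟩ := hM.exists_common_multiple (f := fun z => z + 1) (fun z => by positivity) N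
  refine ⟨d, hd, fun t ht htN => ?_⟩
  obtain ⟨s, rfl⟩ := exists_add_of_le (Order.one_le_iff_pos.2 ht)
  exact add_comm s 1 ▸ hdvd s (le_add_self.trans htN)

theorem exists_modulus_dvd_iff_lt_and_mem (hM : ModelsRCA0 S) {N d : M} (hd : 0 < d)
    (hdvd : ∀ t, 0 < t → t ≤ N → t ∣ d) (X : S) (y : M) :
    ∃ c, 0 < c ∧ (y ≤ N + 1 → ∀ z ≤ N, modulus d z ∣ c ↔ z < y ∧ z ∈ (X : Set M)) := by
  refine hM.induction (fun y => ∃ c, 0 < c ∧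
    (y ≤ N + 1 → ∀ z ≤ N, modulus d z ∣ c ↔ z < y ∧ z ∈ (X : Set M))) ?_ ?_ y
  · refine ⟨1, one_pos, fun _ z _ => ?_⟩
    simpa using fun h => (le_of_dvd h one_pos).not_gt (one_lt_modulus hd z)
  · rintro y ⟨c, hc, ih⟩
    simp only [Order.lt_add_one_iff, le_iff_lt_or_eq (b := y), add_le_add_iff_right]
    by_cases hy : y ∈ (X : Set M)
    · refine ⟨c * modulus d y, mul_pos hc (one_pos.trans (one_lt_modulus hd y)),
        fun hyN z hz => ?_⟩
      rcases eq_or_ne z y with rfl | hzy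
      · simp [hy]
      · simp [modulus_dvd_mul_modulus_iff hdvd hz hyN hzy, ih (hyN.trans le_self_add) z hz, hzy]
    · refine ⟨c, hc, fun hyN z hz => ?_⟩
      rcases eq_or_ne z y with rfl | hzy
      · simp [hy, ih (hyN.trans le_self_add) z hz]
      · simp [ih (hyN.trans le_self_add) z hz, hzy]

theorem exists_modulus_dvd_iff_mem (hM : ModelsRCA0 S) (N : M) :
    ∃ d > 0, ∀ X : S, ∃ c > 0, ∀ z ≤ N, modulus d z ∣ c ↔ z ∈ (X : Set M) := by
  obtain ⟨d, hd, hdvd⟩ := hM.exists_pos_forall_le_dvd N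
  refine ⟨d, hd, fun X => ?_⟩
  obtain ⟨c, hc, hcX⟩ := hM.exists_modulus_dvd_iff_lt_and_mem hd hdvd X (N + 1)
  exact ⟨c, hc, fun z hz => by simp [hcX le_rfl z hz, Order.lt_add_one_iff.2 hz]⟩

theorem mem_iff_modulus_dvd_of_least (hM : ModelsRCA0 S) {N d m : M}
    (hd : ∀ X : S, ∃ c > 0, ∀ z ≤ N, modulus d z ∣ c ↔ z ∈ (X : Set M)) {X : S} (hm : 0 < m)
    (hmX : ∀ z ≤ N, z ∈ (X : Set M) → modulus d z ∣ m)
    (hleast : ∀ y < m, 0 < y → ∃ z ≤ N, z ∈ (X : Set M) ∧ ¬ modulus d z ∣ y) {z : M}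
    (hz : z ≤ N) : z ∈ (X : Set M) ↔ modulus d z ∣ m := by
  obtain ⟨c, _, hc⟩ := hd X
  have hmc : m ∣ c := by
    refine hM.dvd_of_least_common_multiple (A := {a | ∃ z ≤ N, z ∈ (X : Set M) ∧ a = modulus d z})
      hm ?_ (fun y hy hpos => ?_) ?_
    · rintro _ ⟨z, hz, hzX, rfl⟩
      exact hmX z hz hzX
    · obtain ⟨z, hz, hzX, hzy⟩ := hleast y hy hpos
      exact ⟨_, ⟨z, hz, hzX, rfl⟩, hzy⟩
    · rintro _ ⟨z, hz, hzX, rfl⟩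
      exact (hc z hz).2 hzX
  exact ⟨hmX z hz, fun h => (hc z hz).1 (h.trans hmc)⟩

end ModelsRCA0

end Models

section Comprehension

theorem exists_and_iff_not_exists {α : Type*} {C P : α → Prop} (hex : ∃ c, C c)
    (hP : ∀ c c', C c → C c' → P c → P c') : (∃ c, C c ∧ P c) ↔ ¬ ∃ c, C c ∧ ¬ P c := by
  refine ⟨fun ⟨c, hc, h⟩ ⟨c', hc', h'⟩ => h' (hP c c' hc hc' h), fun h => ?_⟩
  obtain ⟨c, hc⟩ := hex
  exact ⟨c, hc, not_not.1 fun h' => h ⟨c, hc, h'⟩⟩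

variable {M : Type u} [CommSemiring M] [LinearOrder M] {S : Set (Set M)}

/-- `z` codes the pair `(x, y)`, where numbers that are not pairs are taken to code `(0, 0)`: this
total version of decoding keeps complements of `Δ⁰₁` relations between components `Σ⁰₁`. -/
def IsUnpair (z x y : M) : Prop :=
  z = ⟪x, y⟫ ∨ x = 0 ∧ y = 0 ∧ ∀ x' ≤ z, ∀ y' ≤ z, ¬ z = ⟪x', y'⟫

instance {n : ℕ} {f g h : (Fin n → M) → M} [PolyFun f] [PolyFun g] [PolyFun h] :
    Delta0Rel S fun v => IsUnpair (f v) (g v) (h v) := by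
  unfold IsUnpair
  infer_instance

variable [CanonicallyOrderedAdd M] [IsStrictOrderedRing M] [SuccAddOrder M]

@[simp]
theorem isUnpair_pairCode {x y x' y' : M} : IsUnpair ⟪x, y⟫ x' y' ↔ x' = x ∧ y' = y := by
  refine ⟨?_, fun ⟨hx, hy⟩ => .inl (by rw [hx, hy])⟩
  rintro (h | ⟨_, _, h⟩)
  · simpa [eq_comm] using h
  · exact absurd rfl (h x (left_le_pairCode x y) y (right_le_pairCode x y))

theorem exists_isUnpair_iff_eq (z : M) : ∃ x y, ∀ x' y', IsUnpair z x' y' ↔ x' = x ∧ y' = y := by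
  by_cases h : ∃ x y, z = ⟪x, y⟫
  · obtain ⟨x, y, rfl⟩ := h
    exact ⟨x, y, fun _ _ => isUnpair_pairCode⟩
  · push Not at h
    exact ⟨0, 0, fun x' y' => by simp [IsUnpair, h]⟩

theorem exists_isUnpair_and_iff_not {R R' : M → M → Prop} (h : ∀ x y, R x y ↔ ¬ R' x y) (z : M) :
    (∃ x y, IsUnpair z x y ∧ R x y) ↔ ¬ ∃ x y, IsUnpair z x y ∧ R' x y := by
  obtain ⟨x, y, hxy⟩ := exists_isUnpair_iff_eq z
  simp [hxy, h, and_assoc]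

namespace ModelsRCA0

theorem exists_set₂ (hM : ModelsRCA0 S) (R R' : M → M → Prop)
    [hR : Sigma1Rel S fun v : Fin 2 → M => R (v 0) (v 1)]
    [hR' : Sigma1Rel S fun v : Fin 2 → M => R' (v 0) (v 1)] (h : ∀ x y, R x y ↔ ¬ R' x y) :
    ∃ X : S, ∀ x y, ⟪x, y⟫ ∈ (X : Set M) ↔ R x y := by
  have {n : ℕ} (f g : (Fin n → M) → M) [PolyFun f] [PolyFun g] := hR.comp₂ f g
  have {n : ℕ} (f g : (Fin n → M) → M) [PolyFun f] [PolyFun g] := hR'.comp₂ f g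
  obtain ⟨X, hX⟩ := hM.comprehension (fun z => ∃ x y, IsUnpair z x y ∧ R x y)
    (fun z => ∃ x y, IsUnpair z x y ∧ R' x y) (exists_isUnpair_and_iff_not h)
  exact ⟨X, fun x y => by simp [hX, and_assoc]⟩

theorem exists_set_pairCode (hM : ModelsRCA0 S) (R R' : M → M → Prop)
    [hR : Sigma1Rel S fun v : Fin 2 → M => R (v 0) (v 1)]
    [hR' : Sigma1Rel S fun v : Fin 2 → M => R' (v 0) (v 1)] (h : ∀ x y, R x y ↔ ¬ R' x y) :
    ∃ X : S, ∀ z, z ∈ (X : Set M) ↔ ∃ x y, z = ⟪x, y⟫ ∧ R x y := by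
  obtain ⟨X, hX⟩ := hM.exists_set₂ R R' h
  obtain ⟨Y, hY⟩ := hM.exists_set fun z => ∃ x ≤ z, ∃ y ≤ z, z = ⟪x, y⟫ ∧ z ∈ (X : Set M)
  refine ⟨Y, fun z => (hY z).trans ⟨?_, ?_⟩⟩
  · rintro ⟨x, _, y, _, rfl, hxy⟩
    exact ⟨x, y, rfl, (hX x y).1 hxy⟩
  · rintro ⟨x, y, rfl, hxy⟩
    exact ⟨x, left_le_pairCode x y, y, right_le_pairCode x y, rfl, (hX x y).2 hxy⟩

theorem exists_set₃ (hM : ModelsRCA0 S) (R R' : M → M → M → Prop)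
    [hR : Sigma1Rel S fun v : Fin 3 → M => R (v 0) (v 1) (v 2)]
    [hR' : Sigma1Rel S fun v : Fin 3 → M => R' (v 0) (v 1) (v 2)]
    (h : ∀ x y z, R x y z ↔ ¬ R' x y z) :
    ∃ X : S, ∀ x y z, ⟪x, ⟪y, z⟫⟫ ∈ (X : Set M) ↔ R x y z := by
  have {n : ℕ} (f g k : (Fin n → M) → M) [PolyFun f] [PolyFun g] [PolyFun k] := hR.comp₃ f g k
  have {n : ℕ} (f g k : (Fin n → M) → M) [PolyFun f] [PolyFun g] [PolyFun k] := hR'.comp₃ f g k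
  obtain ⟨X, hX⟩ := hM.exists_set₂ (fun x t => ∃ y z, IsUnpair t y z ∧ R x y z)
    (fun x t => ∃ y z, IsUnpair t y z ∧ R' x y z) fun x => exists_isUnpair_and_iff_not (h x)
  exact ⟨X, fun x y z => by simp [hX, and_assoc]⟩

end ModelsRCA0

/-- `F` is the graph of the function `f`, as a set of coded pairs. -/
def IsGraph (F : Set M) (f : M → M) : Prop := ∀ z, z ∈ F ↔ ∃ x, z = ⟪x, f x⟫

theorem IsGraph.pairCode_mem_iff {F : Set M} {f : M → M} (hF : IsGraph F f) {x y : M} :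
    ⟪x, y⟫ ∈ F ↔ y = f x := by
  simp [hF ⟪x, y⟫]

theorem ModelsRCA0.exists_graph (hM : ModelsRCA0 S) (R : M → M → Prop)
    [hR : Sigma1Rel S fun v : Fin 2 → M => R (v 0) (v 1)] {f : M → M}
    (h : ∀ x y, R x y ↔ y = f x) : ∃ F : S, IsGraph (F : Set M) f := by
  have {n : ℕ} (f g : (Fin n → M) → M) [PolyFun f] [PolyFun g] := hR.comp₂ f g
  obtain ⟨F, hF⟩ := hM.exists_set_pairCode R (fun x y => ∃ y', ¬ y' = y ∧ R x y')
    fun x y => by simp [h, eq_comm]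
  exact ⟨F, fun z => by simp [hF, h]⟩

end Comprehension

section CodedSets

variable {M : Type u} [CommSemiring M] [LinearOrder M] {S : Set (Set M)}

/-- Membership in the finite set coded by `c = ⟪N, ⟪d, e⟫⟫`, which consists of the `z ≤ N` such
that `modulus d z` divides `e`. -/
def CodeMem (z c : M) : Prop :=
  ∃ N ≤ c, ∃ d ≤ c, ∃ e ≤ c, c = ⟪N, ⟪d, e⟫⟫ ∧ z ≤ N ∧ modulus d z ∣ e

local infix:50 " ∈ᶠ " => CodeMem

theorem CodeMem.le {z c : M} (h : z ∈ᶠ c) : z ≤ c := by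
  obtain ⟨N, hN, _, _, _, _, _, hz, _⟩ := h
  exact hz.trans hN

variable [CanonicallyOrderedAdd M] [IsStrictOrderedRing M] [SuccAddOrder M]

instance {n : ℕ} {f g : (Fin n → M) → M} [PolyFun f] [PolyFun g] :
    Delta0Rel S fun v => f v ∈ᶠ g v := by
  unfold CodeMem
  infer_instance

theorem codeMem_pairCode {z N d e : M} : z ∈ᶠ ⟪N, ⟪d, e⟫⟫ ↔ z ≤ N ∧ modulus d z ∣ e := by
  constructor
  · rintro ⟨N', _, d', _, e', _, h, hz⟩
    obtain ⟨rfl, rfl, rfl⟩ : N = N' ∧ d = d' ∧ e = e' := by simpa using h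
    exact hz
  · intro hz
    exact ⟨N, left_le_pairCode _ _, d, (left_le_pairCode _ _).trans (right_le_pairCode _ _), e,
      (right_le_pairCode _ _).trans (right_le_pairCode _ _), rfl, hz⟩

theorem ModelsRCA0.exists_codeMem_iff (hM : ModelsRCA0 S) (P : M → Prop)
    [Delta0Rel S fun v : Fin 1 → M => P (v 0)] {N : M} (hN : ∀ z, P z → z ≤ N) :
    ∃ c, ∀ z, z ∈ᶠ c ↔ P z := by
  obtain ⟨X, hX⟩ := hM.exists_set P
  obtain ⟨d, _, hd⟩ := hM.exists_modulus_dvd_iff_mem N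
  obtain ⟨e, _, he⟩ := hd X
  refine ⟨⟪N, ⟪d, e⟫⟫, fun z => codeMem_pairCode.trans ?_⟩
  exact ⟨fun ⟨hz, hdvd⟩ => (hX z).1 ((he z hz).1 hdvd),
    fun hz => ⟨hN z hz, (he z (hN z hz)).2 ((hX z).2 hz)⟩⟩

end CodedSets

local infix:50 " ∈ᶠ " => CodeMem

section Recursion

variable {M : Type u} [CommSemiring M] [LinearOrder M] {S : Set (Set M)}

/-- `c` codes a finite piece of the course of values of the recursion that starts with `a` and in
which `⟪x, ⟪v, w⟫⟫ ∈ G` allows the value `v` at `x` to be followed by the value `w` at `x + 1`. -/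
def IsComputation (G : Set M) (a c : M) : Prop :=
  ∀ z ≤ c, z ∈ᶠ c → z = ⟪0, a⟫ ∨
    ∃ x ≤ z, ∃ w ≤ z, ∃ v ≤ c, z = ⟪x + 1, w⟫ ∧ ⟪x, v⟫ ∈ᶠ c ∧ ⟪x, ⟪v, w⟫⟫ ∈ G

variable [CanonicallyOrderedAdd M] [IsStrictOrderedRing M] [SuccAddOrder M]

instance (G : S) {n : ℕ} {f g : (Fin n → M) → M} [PolyFun f] [PolyFun g] :
    Delta0Rel S fun v => IsComputation (G : Set M) (f v) (g v) := by
  unfold IsComputation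
  infer_instance

theorem isComputation_iff {G : Set M} {a c : M} :
    IsComputation G a c ↔ ∀ z, z ∈ᶠ c → z = ⟪0, a⟫ ∨
      ∃ x v w, z = ⟪x + 1, w⟫ ∧ ⟪x, v⟫ ∈ᶠ c ∧ ⟪x, ⟪v, w⟫⟫ ∈ G := by
  refine ⟨fun h z hz => (h z hz.le hz).imp_right ?_, fun h z _ hz => (h z hz).imp_right ?_⟩
  · rintro ⟨x, _, w, _, v, _, h⟩
    exact ⟨x, v, w, h⟩
  · rintro ⟨x, v, w, rfl, hv, hG⟩
    exact ⟨x, le_self_add.trans (left_le_pairCode _ _), w, right_le_pairCode _ _, v,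
      (right_le_pairCode _ _).trans hv.le, rfl, hv, hG⟩

namespace IsComputation

variable {G : Set M} {a c : M}

theorem eq_of_zero (hc : IsComputation G a c) {v : M} (hv : ⟪0, v⟫ ∈ᶠ c) : v = a := by
  simpa [eq_comm (a := (0 : M))] using isComputation_iff.1 hc _ hv

theorem exists_of_succ (hc : IsComputation G a c) {x w : M} (hw : ⟪x + 1, w⟫ ∈ᶠ c) :
    ∃ v, ⟪x, v⟫ ∈ᶠ c ∧ ⟪x, ⟪v, w⟫⟫ ∈ G := by
  simpa [← and_assoc] using isComputation_iff.1 hc _ hw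

end IsComputation

namespace ModelsRCA0

theorem computation_unique (hM : ModelsRCA0 S) {G : Set M}
    (hG : ∀ x v w w', ⟪x, ⟪v, w⟫⟫ ∈ G → ⟪x, ⟪v, w'⟫⟫ ∈ G → w = w') {a c c' : M}
    (hc : IsComputation G a c) (hc' : IsComputation G a c') {x v v' : M} (hv : ⟪x, v⟫ ∈ᶠ c)
    (hv' : ⟪x, v'⟫ ∈ᶠ c') : v = v' := by
  suffices ∀ v ≤ c, ∀ v' ≤ c', ⟪x, v⟫ ∈ᶠ c → ⟪x, v'⟫ ∈ᶠ c' → v = v' from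
    this v ((right_le_pairCode _ _).trans hv.le) v' ((right_le_pairCode _ _).trans hv'.le) hv hv'
  refine hM.induction
    (fun x => ∀ v ≤ c, ∀ v' ≤ c', ⟪x, v⟫ ∈ᶠ c → ⟪x, v'⟫ ∈ᶠ c' → v = v') ?_ ?_ x
  · intro v _ v' _ hv hv'
    rw [hc.eq_of_zero hv, hc'.eq_of_zero hv']
  · intro x ih w _ w' _ hw hw'
    obtain ⟨v, hv, hvw⟩ := hc.exists_of_succ hw
    obtain ⟨v', hv', hvw'⟩ := hc'.exists_of_succ hw'
    obtain rfl := ih v ((right_le_pairCode _ _).trans hv.le) v'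
      ((right_le_pairCode _ _).trans hv'.le) hv hv'
    exact hG x v w w' hvw hvw'

theorem exists_computation (hM : ModelsRCA0 S) (G : S)
    (hG : ∀ x v, ∃ w, ⟪x, ⟪v, w⟫⟫ ∈ (G : Set M)) (a x : M) :
    ∃ c v, IsComputation (G : Set M) a c ∧ ⟪x, v⟫ ∈ᶠ c := by
  refine hM.induction (fun x => ∃ c v, IsComputation (G : Set M) a c ∧ ⟪x, v⟫ ∈ᶠ c) ?_ ?_ x
  · obtain ⟨c, hc⟩ := hM.exists_codeMem_iff (fun z => z = ⟪0, a⟫) fun z hz => hz.le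
    exact ⟨c, a, fun z _ hz => .inl ((hc z).1 hz), (hc _).2 rfl⟩
  · rintro x ⟨c, v, hc, hv⟩
    obtain ⟨w, hw⟩ := hG x v
    obtain ⟨c', hc'⟩ := hM.exists_codeMem_iff (fun z => z ∈ᶠ c ∨ z = ⟪x + 1, w⟫)
      (N := c + ⟪x + 1, w⟫)
      (by rintro z (hz | rfl); exacts [hz.le.trans le_self_add, le_add_self])
    refine ⟨c', w, isComputation_iff.2 fun z hz => ?_, (hc' _).2 (.inr rfl)⟩
    rcases (hc' z).1 hz with hz | rfl
    · refine (isComputation_iff.1 hc z hz).imp_right ?_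
      rintro ⟨x, v, w, rfl, hv, hw⟩
      exact ⟨x, v, w, rfl, (hc' _).2 (.inl hv), hw⟩
    · exact .inr ⟨x, v, w, rfl, (hc' _).2 (.inl hv), hw⟩

theorem exists_rec_of_existsUnique (hM : ModelsRCA0 S) (G : S)
    (hG : ∀ x v, ∃! w, ⟪x, ⟪v, w⟫⟫ ∈ (G : Set M)) (a : M) :
    ∃ (F : S) (f : M → M), IsGraph (F : Set M) f ∧ f 0 = a ∧
      ∀ x, ⟪x, ⟪f x, f (x + 1)⟫⟫ ∈ (G : Set M) := by
  have exists_value (x : M) : ∃ v c, IsComputation (G : Set M) a c ∧ ⟪x, v⟫ ∈ᶠ c :=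
    exists_comm.1 (hM.exists_computation G (fun x v => (hG x v).exists) a x)
  choose f cf hcomp hmem using exists_value
  have eq_value {x v c : M} (hc : IsComputation (G : Set M) a c) (hv : ⟪x, v⟫ ∈ᶠ c) : v = f x :=
    hM.computation_unique (fun x v _ _ => (hG x v).unique) hc (hcomp x) hv (hmem x)
  obtain ⟨F, hF⟩ := hM.exists_graph (f := f)
    (fun x v => ∃ c, IsComputation (G : Set M) a c ∧ ⟪x, v⟫ ∈ᶠ c)
    fun x v => ⟨fun ⟨c, hc, hv⟩ => eq_value hc hv, fun h => h ▸ ⟨cf x, hcomp x, hmem x⟩⟩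
  refine ⟨F, f, hF, (hcomp 0).eq_of_zero (hmem 0), fun x => ?_⟩
  obtain ⟨v, hv, hvG⟩ := (hcomp (x + 1)).exists_of_succ (hmem (x + 1))
  rwa [eq_value (hcomp (x + 1)) hv] at hvG

theorem exists_rec (hM : ModelsRCA0 S) (R : M → M → M → Prop)
    [Delta0Rel S fun v : Fin 3 → M => R (v 0) (v 1) (v 2)] (hR : ∀ x v, ∃ w, R x v w) (a : M) :
    ∃ (F : S) (f : M → M), IsGraph (F : Set M) f ∧ f 0 = a ∧ ∀ x, R x (f x) (f (x + 1)) := by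
  obtain ⟨X, hX⟩ := hM.exists_set₃ R (fun x v w => ¬ R x v w) fun _ _ _ => not_not.symm
  -- Always choosing the least possible value makes the recursion deterministic.
  obtain ⟨G, hG⟩ := hM.exists_set₃
    (fun x v w => ⟪x, ⟪v, w⟫⟫ ∈ (X : Set M) ∧ ∀ y < w, ¬ ⟪x, ⟪v, y⟫⟫ ∈ (X : Set M))
    (fun x v w => ¬ (⟪x, ⟪v, w⟫⟫ ∈ (X : Set M) ∧ ∀ y < w, ¬ ⟪x, ⟪v, y⟫⟫ ∈ (X : Set M)))
    fun _ _ _ => not_not.symm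
  simp only [hX] at hG
  have existsUnique_mem (x v : M) : ∃! w, ⟪x, ⟪v, w⟫⟫ ∈ (G : Set M) := by
    obtain ⟨Y, hY⟩ := hM.exists_set fun w => ⟪x, ⟪v, w⟫⟫ ∈ (X : Set M)
    simp only [hX] at hY
    obtain ⟨w, hw, hleast⟩ := hM.exists_least Y ((hR x v).imp fun w => (hY w).2)
    simp only [hY] at hw hleast
    refine ⟨w, (hG x v w).2 ⟨hw, hleast⟩, fun w' hw' => ?_⟩
    obtain ⟨hw', hleast'⟩ := (hG x v w').1 hw'
    exact eq_of_le_of_not_lt (not_lt.1 fun h => hleast' w h hw) fun h => hleast w' h hw'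
  obtain ⟨F, f, hF, hf0, hf⟩ := hM.exists_rec_of_existsUnique G existsUnique_mem a
  exact ⟨F, f, hF, hf0, fun x => ((hG _ _ _).1 (hf x)).1⟩

end ModelsRCA0

end Recursion

section Reachability

variable {M : Type u} [CommSemiring M] [LinearOrder M] {S : Set (Set M)}

/-- `c` codes a set of vertices `⟪q, j⟫` which, at the levels from `l` to `n`, consists of those
from which a path in the level graph `E` of width `b` leads to level `n`. -/
def IsReachCode (b : M) (E : Set M) (l n c : M) : Prop :=
  ∀ q ≤ b, ∀ j ≤ n, l ≤ j → (⟪q, j⟫ ∈ᶠ c ↔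
    j = n ∨ ∃ r ≤ b, ⟪⟪q, j⟫, ⟪r, j + 1⟫⟫ ∈ E ∧ ⟪r, j + 1⟫ ∈ᶠ c)

/-- `W` consists of the codes `⟪q, ⟪j, n⟫⟫` such that a path in the level graph `E` of width `b`
leads from the vertex `⟪q, j⟫` to level `n`. Only the case `q ≤ b`, `j ≤ n` is specified. -/
structure IsReachability (b : M) (E W : Set M) : Prop where
  self (n : M) {q : M} (hq : q ≤ b) : ⟪q, ⟪n, n⟫⟫ ∈ W
  step {j n q : M} (hj : j < n) (hq : q ≤ b) :
    ⟪q, ⟪j, n⟫⟫ ∈ W ↔ ∃ r ≤ b, ⟪⟪q, j⟫, ⟪r, j + 1⟫⟫ ∈ E ∧ ⟪r, ⟪j + 1, n⟫⟫ ∈ W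

variable [CanonicallyOrderedAdd M] [IsStrictOrderedRing M] [SuccAddOrder M]

instance (b : M) (E : S) {k : ℕ} {f g h : (Fin k → M) → M} [PolyFun f] [PolyFun g] [PolyFun h] :
    Delta0Rel S fun v => IsReachCode b (E : Set M) (f v) (g v) (h v) := by
  unfold IsReachCode
  infer_instance

namespace ModelsRCA0

theorem induction_down (hM : ModelsRCA0 S) (P : M → Prop)
    [hP : Sigma1Rel S fun v : Fin 1 → M => P (v 0)] {n : M} (top : P n)
    (pred : ∀ j < n, P (j + 1) → P j) {j : M} (hj : j ≤ n) : P j := by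
  have {k : ℕ} (f : (Fin k → M) → M) [PolyFun f] := hP.comp₁ f
  have exists_at_distance (x : M) : ∃ j, (x + j = n ∨ n < x) ∧ P j := by
    refine hM.induction (fun x => ∃ j, (x + j = n ∨ n < x) ∧ P j) ⟨n, .inl (zero_add n), top⟩ ?_ x
    rintro x ⟨j, rfl | hx, hPj⟩
    · rcases eq_zero_or_pos j with rfl | hpos
      · exact ⟨_, .inr (by simp), top⟩
      · obtain ⟨i, rfl⟩ := exists_add_of_le (Order.one_le_iff_pos.2 hpos)
        rw [add_comm 1 i] at pred hPj
        refine ⟨i, .inl (by ring), pred i ?_ hPj⟩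
        exact (lt_add_one i).trans_le le_add_self
    · exact ⟨n, .inr (hx.trans_le le_self_add), top⟩
  obtain ⟨x, rfl⟩ := exists_add_of_le hj
  obtain ⟨i, hi | hi, hPi⟩ := exists_at_distance x
  · rw [add_comm, add_left_inj] at hi
    exact hi ▸ hPi
  · exact absurd le_add_self hi.not_ge

theorem exists_isReachCode (hM : ModelsRCA0 S) (b : M) (E : S) (n : M) :
    ∃ c, IsReachCode b (E : Set M) 0 n c := by
  have exists_apply_step (c : M) : ∃ c', ∀ q ≤ b, ∀ j ≤ n, ⟪q, j⟫ ∈ᶠ c' ↔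
      j = n ∨ ∃ r ≤ b, ⟪⟪q, j⟫, ⟪r, j + 1⟫⟫ ∈ (E : Set M) ∧ ⟪r, j + 1⟫ ∈ᶠ c := by
    obtain ⟨c', hc'⟩ := hM.exists_codeMem_iff (fun z => ∃ q ≤ b, ∃ j ≤ n, z = ⟪q, j⟫ ∧
      (j = n ∨ ∃ r ≤ b, ⟪⟪q, j⟫, ⟪r, j + 1⟫⟫ ∈ (E : Set M) ∧ ⟪r, j + 1⟫ ∈ᶠ c)) (N := ⟪b, n⟫)
      (by rintro z ⟨q, hq, j, hj, rfl, -⟩; exact pairCode_le_pairCode hq hj)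
    refine ⟨c', fun q hq j hj => (hc' _).trans ⟨?_, fun h => ⟨q, hq, j, hj, rfl, h⟩⟩⟩
    rintro ⟨q', _, j', _, h, hstep⟩
    obtain ⟨rfl, rfl⟩ := pairCode_inj.1 h
    exact hstep
  refine hM.induction_down (fun l => ∃ c, IsReachCode b (E : Set M) l n c) ?_ ?_ (zero_le (a := n))
  · obtain ⟨c, hc⟩ := exists_apply_step 0
    refine ⟨c, fun q hq j hj hnj => ?_⟩
    obtain rfl := hj.antisymm hnj
    simp [hc q hq j]
  · rintro l - ⟨c, hc⟩
    obtain ⟨c', hc'⟩ := exists_apply_step c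
    refine ⟨c', fun q hq j hj hlj => (hc' q hq j hj).trans (or_congr_right' fun hjn => ?_)⟩
    have hj1 : j + 1 ≤ n := Order.add_one_le_of_lt (hj.lt_of_ne hjn)
    refine exists_congr fun r => and_congr_right fun hr => and_congr_right fun _ => ?_
    rw [hc r hr (j + 1) hj1 (by gcongr), hc' r hr (j + 1) hj1]

theorem isReachCode_unique (hM : ModelsRCA0 S) {b : M} {E : S} {n c c' : M}
    (hc : IsReachCode b (E : Set M) 0 n c) (hc' : IsReachCode b (E : Set M) 0 n c') {q j : M}
    (hq : q ≤ b) (hj : j ≤ n) : ⟪q, j⟫ ∈ᶠ c ↔ ⟪q, j⟫ ∈ᶠ c' := by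
  refine hM.induction_down (fun j => ∀ q ≤ b, ⟪q, j⟫ ∈ᶠ c ↔ ⟪q, j⟫ ∈ᶠ c') ?_ ?_ hj q hq
  · intro q hq
    simp [hc q hq n le_rfl, hc' q hq n le_rfl]
  · intro j hj ih q hq
    rw [hc q hq j hj.le zero_le, hc' q hq j hj.le zero_le]
    exact or_congr_right <| exists_congr fun r => and_congr_right fun hr =>
      and_congr_right fun _ => ih r hr

theorem exists_isReachability (hM : ModelsRCA0 S) (b : M) (E : S) :
    ∃ W : S, IsReachability b (E : Set M) W := by
  choose code hcode using hM.exists_isReachCode b E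
  have mem_code_iff {q j n c : M} (hc : IsReachCode b (E : Set M) 0 n c) :
      (q ≤ b ∧ j ≤ n ∧ ⟪q, j⟫ ∈ᶠ c) ↔ q ≤ b ∧ j ≤ n ∧ ⟪q, j⟫ ∈ᶠ code n :=
    and_congr_right fun hq => and_congr_right fun hj => hM.isReachCode_unique hc (hcode n) hq hj
  obtain ⟨W, hW⟩ := hM.exists_set₃
    (fun q j n => ∃ c, IsReachCode b (E : Set M) 0 n c ∧ (q ≤ b ∧ j ≤ n ∧ ⟪q, j⟫ ∈ᶠ c))
    (fun q j n => ∃ c, IsReachCode b (E : Set M) 0 n c ∧ ¬ (q ≤ b ∧ j ≤ n ∧ ⟪q, j⟫ ∈ᶠ c))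
    fun q j n => exists_and_iff_not_exists ⟨_, hcode n⟩ fun c c' hc hc' h =>
      (mem_code_iff hc').2 ((mem_code_iff hc).1 h)
  have mem_W_iff (q j n : M) : ⟪q, ⟪j, n⟫⟫ ∈ (W : Set M) ↔ q ≤ b ∧ j ≤ n ∧ ⟪q, j⟫ ∈ᶠ code n :=
    (hW q j n).trans ⟨fun ⟨c, hc, h⟩ => (mem_code_iff hc).1 h, fun h => ⟨_, hcode n, h⟩⟩
  refine ⟨W, fun n q hq => ?_, fun {j n q} hj hq => ?_⟩
  · simp [mem_W_iff, hq, hcode n q hq n]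
  · simp only [mem_W_iff, hq, hj.le, true_and, hcode n q hq j hj.le zero_le, hj.ne, false_or]
    refine exists_congr fun r => and_congr_right fun hr => and_congr_right fun _ => ?_
    simp [hr, Order.add_one_le_of_lt hj]

end ModelsRCA0

end Reachability

section Extendibility

variable {M : Type u} [CommSemiring M] [LinearOrder M] {S : Set (Set M)}

/-- `m` is a positive common multiple of the moduli that code the vertices at level `i` from which
level `n` is reached, according to `W`. -/
structure IsReachMultiple (b d : M) (W : Set M) (m i n : M) : Prop where
  pos : 0 < m
  le : i ≤ n
  modulus_dvd : ∀ r ≤ b, ⟪r, ⟪i, n⟫⟫ ∈ W → modulus d r ∣ m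

theorem isReachMultiple_iff {b d m i n : M} {W : Set M} : IsReachMultiple b d W m i n ↔
    0 < m ∧ i ≤ n ∧ ∀ r ≤ b, ⟪r, ⟪i, n⟫⟫ ∈ W → modulus d r ∣ m :=
  ⟨fun ⟨hm, hn, hdvd⟩ => ⟨hm, hn, hdvd⟩, fun ⟨hm, hn, hdvd⟩ => ⟨hm, hn, hdvd⟩⟩

/-- In the level graph of width `b` with reachability `W`, paths from the vertex `⟪q, j⟫` lead to
all later levels. -/
def IsExtendible (b : M) (W : Set M) (q j : M) : Prop :=
  q ≤ b ∧ ∀ n, j ≤ n → ⟪q, ⟪j, n⟫⟫ ∈ W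

variable [CanonicallyOrderedAdd M] [IsStrictOrderedRing M] [SuccAddOrder M]

theorem ModelsRCA0.reachability_mono_of_level (hM : ModelsRCA0 S) {b : M} {E W : S}
    (hW : IsReachability b (E : Set M) W) {l n n' : M} (hn : l ≤ n) (hn' : l ≤ n')
    (hl : ∀ q ≤ b, ⟪q, ⟪l, n⟫⟫ ∈ (W : Set M) → ⟪q, ⟪l, n'⟫⟫ ∈ (W : Set M)) {j q : M} (hj : j ≤ l)
    (hq : q ≤ b) : ⟪q, ⟪j, n⟫⟫ ∈ (W : Set M) → ⟪q, ⟪j, n'⟫⟫ ∈ (W : Set M) := by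
  refine hM.induction_down (fun j => ∀ q ≤ b, ⟪q, ⟪j, n⟫⟫ ∈ (W : Set M) →
    ⟪q, ⟪j, n'⟫⟫ ∈ (W : Set M)) hl ?_ hj q hq
  intro j hj ih q hq
  rw [hW.step (hj.trans_le hn) hq, hW.step (hj.trans_le hn') hq]
  exact fun ⟨r, hr, hqr, hrn⟩ => ⟨r, hr, hqr, ih r hr hrn⟩

theorem ModelsRCA0.reachability_anti (hM : ModelsRCA0 S) {b : M} {E W : S}
    (hW : IsReachability b (E : Set M) W) {j n n' q : M} (hj : j ≤ n) (hn : n ≤ n') (hq : q ≤ b) :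
    ⟪q, ⟪j, n'⟫⟫ ∈ (W : Set M) → ⟪q, ⟪j, n⟫⟫ ∈ (W : Set M) :=
  hM.reachability_mono_of_level hW hn le_rfl (fun _ hq _ => hW.self n hq) hj hq

instance (b d : M) (W : S) {k : ℕ} {f g h : (Fin k → M) → M} [PolyFun f] [PolyFun g] [PolyFun h] :
    Delta0Rel S fun v => IsReachMultiple b d (W : Set M) (f v) (g v) (h v) := by
  simp only [isReachMultiple_iff]
  infer_instance

namespace IsReachMultiple

variable {b d m i n : M} {W : S}

theorem mono (hm : IsReachMultiple b d (W : Set M) m i n) (hM : ModelsRCA0 S) {E : S}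
    (hW : IsReachability b (E : Set M) W) {n' : M} (hn : n ≤ n') :
    IsReachMultiple b d (W : Set M) m i n' where
  pos := hm.pos
  le := hm.le.trans hn
  modulus_dvd r hr h := hm.modulus_dvd r hr (hM.reachability_anti hW hm.le hn hr h)

theorem mem_iff_modulus_dvd (hm : IsReachMultiple b d (W : Set M) m i n) (hM : ModelsRCA0 S)
    (hd : ∀ X : S, ∃ c > 0, ∀ z ≤ b, modulus d z ∣ c ↔ z ∈ (X : Set M))
    (hleast : ∀ y < m, ¬ IsReachMultiple b d (W : Set M) y i n) {r : M} (hr : r ≤ b) :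
    ⟪r, ⟪i, n⟫⟫ ∈ (W : Set M) ↔ modulus d r ∣ m := by
  obtain ⟨X, hX⟩ := hM.exists_set fun r => ⟪r, ⟪i, n⟫⟫ ∈ (W : Set M)
  rw [← hX r]
  refine hM.mem_iff_modulus_dvd_of_least hd hm.pos
    (fun r hr hrX => hm.modulus_dvd r hr ((hX r).1 hrX)) (fun y hy hpos => ?_) hr
  by_contra! hdvd
  exact hleast y hy ⟨hpos, hm.le, fun r hr hrW => hdvd r hr ((hX r).2 hrW)⟩

end IsReachMultiple

namespace ModelsSigma2Ind

/-- Here `m` is a limit inferior, if `∃ n, Q y i n` is read as: `y` is a value at `i`. -/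
theorem exists_liminf (hM : ModelsSigma2Ind S) (Q : M → M → M → Prop)
    [hQ : Delta0Rel S fun v : Fin 3 → M => Q (v 0) (v 1) (v 2)] {B : M}
    (hB : ∀ i, ∃ n, Q B i n) :
    ∃ m, (∃ l, ∀ i, l ≤ i → ∀ y < m, ∀ n, ¬ Q y i n) ∧ ∀ k, ∃ i, k ≤ i ∧ ∃ n, Q m i n := by
  have {k : ℕ} (f g h : (Fin k → M) → M) [PolyFun f] [PolyFun g] [PolyFun h] := hQ.comp₃ f g h
  obtain ⟨m, ⟨l, hl⟩, hm⟩ : ∃ m, (∃ l, ∀ i n, ∀ y < m, l ≤ i → ¬ Q y i n) ∧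
      ¬ ∃ l, ∀ i n, ∀ y < m + 1, l ≤ i → ¬ Q y i n := by
    by_contra! hstep
    obtain ⟨l, hl⟩ := hM.sigma2_induction (fun m => ∃ l, ∀ i n, ∀ y < m, l ≤ i → ¬ Q y i n)
      ⟨0, fun _ _ y hy => absurd hy not_lt_zero⟩ hstep (B + 1)
    obtain ⟨n, hn⟩ := hB l
    exact hl l n B (lt_add_one B) le_rfl hn
  refine ⟨m, ⟨l, fun i hi y hy n => hl i n y hy hi⟩, fun k => ?_⟩
  push Not at hm
  obtain ⟨i, n, y, hy, hi, hQ⟩ := hm (max k l)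
  obtain ⟨hki, hli⟩ := max_le_iff.1 hi
  obtain rfl : y = m := (Order.lt_add_one_iff.1 hy).eq_of_not_lt fun hy => hl i n y hy hli hQ
  exact ⟨i, hki, n, hQ⟩

theorem exists_stabilizer (hM : ModelsSigma2Ind S) {b : M} {E W : S}
    (hW : IsReachability b (E : Set M) W) :
    ∃ D : S, (∀ j, ∃ n, ⟪j, n⟫ ∈ (D : Set M)) ∧ ∀ j n, ⟪j, n⟫ ∈ (D : Set M) → j ≤ n ∧
      ∀ q ≤ b, ⟪q, ⟪j, n⟫⟫ ∈ (W : Set M) → IsExtendible b W q j := by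
  obtain ⟨d, hd, hcode⟩ := hM.exists_modulus_dvd_iff_mem b
  obtain ⟨B, hB, hBdvd⟩ := hM.exists_common_multiple (f := modulus d)
    (fun z => one_pos.trans (one_lt_modulus hd z)) b
  obtain ⟨m, ⟨l, hl⟩, hm⟩ := hM.exists_liminf (IsReachMultiple b d (W : Set M))
    fun i => ⟨i, hB, le_rfl, fun r hr _ => hBdvd r hr⟩
  obtain ⟨D, hD⟩ := hM.exists_set₂
    (fun j n => ∃ i ≤ n, j ≤ i ∧ l ≤ i ∧ IsReachMultiple b d (W : Set M) m i n)
    (fun j n => ¬ ∃ i ≤ n, j ≤ i ∧ l ≤ i ∧ IsReachMultiple b d (W : Set M) m i n)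
    fun _ _ => not_not.symm
  refine ⟨D, fun j => ?_, fun j n hjn => ?_⟩
  · obtain ⟨i, hi, n, hmin⟩ := hm (max j l)
    exact ⟨n, (hD j n).2 ⟨i, hmin.le, (max_le_iff.1 hi).1, (max_le_iff.1 hi).2, hmin⟩⟩
  · obtain ⟨i, hin, hji, hli, hmin⟩ := (hD j n).1 hjn
    refine ⟨hji.trans hin, fun q hq hqn => ⟨hq, fun n' hjn' => ?_⟩⟩
    rcases le_total n' n with hn | hn
    · exact hM.reachability_anti hW hjn' hn hq hqn
    · have hmin' := hmin.mono hM.toModelsRCA0 hW hn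
      refine hM.reachability_mono_of_level hW hin (hin.trans hn) (fun r hr hrn => ?_) hji hq hqn
      exact (hmin'.mem_iff_modulus_dvd hM.toModelsRCA0 hcode (fun y hy => hl i hli y hy n') hr).2
        (hmin.modulus_dvd r hr hrn)

theorem exists_set_isExtendible (hM : ModelsSigma2Ind S) {b : M} {E W : S}
    (hW : IsReachability b (E : Set M) W) :
    ∃ J : S, ∀ v, v ∈ (J : Set M) ↔ ∃ q j, v = ⟪q, j⟫ ∧ IsExtendible b (W : Set M) q j := by
  obtain ⟨D, hDex, hD⟩ := hM.exists_stabilizer hW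
  have isExtendible_iff {q j n : M} (hjn : ⟪j, n⟫ ∈ (D : Set M)) :
      IsExtendible b (W : Set M) q j ↔ q ≤ b ∧ ⟪q, ⟪j, n⟫⟫ ∈ (W : Set M) :=
    ⟨fun ⟨hq, h⟩ => ⟨hq, h n (hD j n hjn).1⟩, fun ⟨hq, h⟩ => (hD j n hjn).2 q hq h⟩
  obtain ⟨J, hJ⟩ := hM.exists_set_pairCode
    (fun q j => ∃ n, ⟪j, n⟫ ∈ (D : Set M) ∧ (q ≤ b ∧ ⟪q, ⟪j, n⟫⟫ ∈ (W : Set M)))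
    (fun q j => ∃ n, ⟪j, n⟫ ∈ (D : Set M) ∧ ¬ (q ≤ b ∧ ⟪q, ⟪j, n⟫⟫ ∈ (W : Set M)))
    fun q j => exists_and_iff_not_exists (hDex j) fun n n' hn hn' h =>
      (isExtendible_iff hn').1 ((isExtendible_iff hn).2 h)
  refine ⟨J, fun v => (hJ v).trans (exists₂_congr fun q j => and_congr_right fun _ => ?_)⟩
  refine ⟨fun ⟨n, hn, h⟩ => (isExtendible_iff hn).2 h, fun h => ?_⟩
  obtain ⟨n, hn⟩ := hDex j
  exact ⟨n, hn, (isExtendible_iff hn).1 h⟩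

theorem exists_isExtendible_of_isExtendible (hM : ModelsSigma2Ind S) {b : M} {E W : S}
    (hW : IsReachability b (E : Set M) W) {q j : M} (hqj : IsExtendible b (W : Set M) q j) :
    ∃ r, ⟪⟪q, j⟫, ⟪r, j + 1⟫⟫ ∈ (E : Set M) ∧ IsExtendible b (W : Set M) r (j + 1) := by
  obtain ⟨D, hDex, hD⟩ := hM.exists_stabilizer hW
  obtain ⟨n, hn⟩ := hDex (j + 1)
  obtain ⟨hjn, hstable⟩ := hD (j + 1) n hn
  obtain ⟨hq, hreach⟩ := hqj
  have hlt : j < n := (lt_add_one j).trans_le hjn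
  obtain ⟨r, hr, hqr, hrn⟩ := (hW.step hlt hq).1 (hreach n hlt.le)
  exact ⟨r, hqr, hstable r hr hrn⟩

end ModelsSigma2Ind

end Extendibility

section Konig

variable {M : Type u} [CommSemiring M] [LinearOrder M] {S : Set (Set M)}

/-- The edges in `E` lead from vertices `⟪r, i⟫` to vertices `⟪r', i + 1⟫` with `r` and `r'` at most
`b`. -/
def IsLevelGraph (b : M) (E : Set M) : Prop :=
  ∀ z ∈ E, ∃ r ≤ b, ∃ r' ≤ b, ∃ i, z = ⟪⟪r, i⟫, ⟪r', i + 1⟫⟫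

/-- `v` is the entry with index `i` of the sequence that `c` and `d` code through Gödel's
β-function. -/
def IsEntry (c d i v : M) : Prop :=
  v < modulus d i ∧ ∃ k ≤ c, c = k * modulus d i + v

/-- `c` and `d` code a sequence whose entries with indices `0, …, m` form a path in `E`. -/
def IsCodedPath (E : Set M) (m c d : M) : Prop :=
  ∀ j < m, ∃ v w, IsEntry c d j v ∧ IsEntry c d (j + 1) w ∧ ⟪v, w⟫ ∈ E

variable [CanonicallyOrderedAdd M] [IsStrictOrderedRing M] [SuccAddOrder M]

instance {n : ℕ} {f g h k : (Fin n → M) → M} [PolyFun f] [PolyFun g] [PolyFun h] [PolyFun k] :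
    Delta0Rel S fun v => IsEntry (f v) (g v) (h v) (k v) := by
  unfold IsEntry
  infer_instance

theorem isEntry_iff {c d i v : M} :
    IsEntry c d i v ↔ v < modulus d i ∧ ∃ k, c = k * modulus d i + v := by
  refine and_congr_right fun hv => exists_congr fun k => and_iff_right_of_imp ?_
  rintro rfl
  exact (le_mul_of_one_le_right' (Order.one_le_iff_pos.2 (zero_le.trans_lt hv))).trans le_self_add

theorem mul_add_lt_mul_add {y k k' v w : M} (hk : k < k') (hv : v < y) :
    k * y + v < k' * y + w :=
  calc k * y + v < k * y + y := by gcongr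
    _ = (k + 1) * y := (add_one_mul k y).symm
    _ ≤ k' * y := by gcongr; exact Order.add_one_le_of_lt hk
    _ ≤ k' * y + w := le_self_add

theorem IsEntry.unique {c d i v w : M} (hv : IsEntry c d i v) (hw : IsEntry c d i w) : v = w := by
  obtain ⟨hv, k, _, hk⟩ := hv
  obtain ⟨hw, k', _, hk'⟩ := hw
  rcases lt_trichotomy k k' with h | rfl | h
  · exact absurd (hk.symm.trans hk') (mul_add_lt_mul_add h hv).ne
  · exact add_left_cancel (hk.symm.trans hk')
  · exact absurd (hk'.symm.trans hk) (mul_add_lt_mul_add h hw).ne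

namespace ModelsRCA0

theorem mem_reachability_of_isCodedPath (hM : ModelsRCA0 S) {b : M} {E W : S}
    (hE : IsLevelGraph b (E : Set M)) (hW : IsReachability b (E : Set M) W) {n m c d q : M}
    (hpath : IsCodedPath (E : Set M) m c d) (hn : n ≤ m) (hq : q ≤ b)
    (hq₀ : IsEntry c d 0 ⟪q, 0⟫) : ⟪q, ⟪0, n⟫⟫ ∈ (W : Set M) := by
  refine hM.induction_down (fun j => ∀ r ≤ b, IsEntry c d j ⟪r, j⟫ → ⟪r, ⟪j, n⟫⟫ ∈ (W : Set M))
    (fun r hr _ => hW.self n hr) ?_ (zero_le (a := n)) q hq hq₀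
  intro j hj ih r hr hrj
  obtain ⟨v, w, hv, hw, hvw⟩ := hpath j (hj.trans_le hn)
  obtain rfl := hv.unique hrj
  obtain ⟨r₁, _, r', hr', i, heq⟩ := hE _ hvw
  obtain ⟨⟨rfl, rfl⟩, rfl⟩ : (r = r₁ ∧ j = i) ∧ w = ⟪r', i + 1⟫ := by simpa using heq
  exact (hW.step hj hr).2 ⟨r', hr', hvw, ih r' hr' hw⟩

theorem exists_path_of_forall_exists_edge (hM : ModelsRCA0 S) (E J : S) {a : M}
    (ha : a ∈ (J : Set M)) (hJ : ∀ v ∈ (J : Set M), ∃ w ∈ (J : Set M), ⟪v, w⟫ ∈ (E : Set M)) :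
    ∃ (P : S) (f : M → M), IsGraph (P : Set M) f ∧ f 0 = a ∧
      ∀ x, ⟪f x, f (x + 1)⟫ ∈ (E : Set M) := by
  obtain ⟨P, f, hP, hf0, hf⟩ := hM.exists_rec
    (fun _ v w => v ∈ (J : Set M) → w ∈ (J : Set M) ∧ ⟪v, w⟫ ∈ (E : Set M))
    (fun _ v => by
      by_cases hv : v ∈ (J : Set M)
      · obtain ⟨w, hw⟩ := hJ v hv
        exact ⟨w, fun _ => hw⟩
      · exact ⟨0, fun h => absurd h hv⟩) a
  have mem_J (x : M) : f x ∈ (J : Set M) := by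
    suffices ∃ v, ⟪x, v⟫ ∈ (P : Set M) ∧ v ∈ (J : Set M) by
      simpa [hP.pairCode_mem_iff] using this
    refine hM.induction (fun x => ∃ v, ⟪x, v⟫ ∈ (P : Set M) ∧ v ∈ (J : Set M)) ?_ ?_ x
    · exact ⟨a, hP.pairCode_mem_iff.2 hf0.symm, ha⟩
    · rintro x ⟨v, hv, hvJ⟩
      obtain rfl := hP.pairCode_mem_iff.1 hv
      exact ⟨_, hP.pairCode_mem_iff.2 rfl, (hf x hvJ).1⟩
  exact ⟨P, f, hP, hf0, fun x => (hf x (mem_J x)).2⟩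

end ModelsRCA0

theorem ModelsSigma2Ind.exists_infinite_path (hM : ModelsSigma2Ind S) {b : M} {E : S}
    (hE : IsLevelGraph b (E : Set M)) {q : M} (hq : q ≤ b)
    (hlong : ∀ n, ∃ m, n ≤ m ∧ ∃ c d, IsEntry c d 0 ⟪q, 0⟫ ∧ IsCodedPath (E : Set M) m c d) :
    ∃ (P : S) (f : M → M), IsGraph (P : Set M) f ∧ f 0 = ⟪q, 0⟫ ∧
      ∀ x, ⟪f x, f (x + 1)⟫ ∈ (E : Set M) := by
  obtain ⟨W, hW⟩ := hM.exists_isReachability b E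
  obtain ⟨J, hJ⟩ := hM.exists_set_isExtendible hW
  refine hM.exists_path_of_forall_exists_edge E J ((hJ _).2 ⟨q, 0, rfl, hq, fun n _ => ?_⟩)
    fun v hv => ?_
  · obtain ⟨m, hn, c, d, hq₀, hpath⟩ := hlong n
    exact hM.mem_reachability_of_isCodedPath hE hW hpath hn hq hq₀
  · obtain ⟨r, j, rfl, hrj⟩ := (hJ v).1 hv
    obtain ⟨r', hedge, hr'⟩ := hM.exists_isExtendible_of_isExtendible hW hrj
    exact ⟨_, (hJ _).2 ⟨r', j + 1, rfl, hr'⟩, hedge⟩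

end Konig

section NumberSort

open Term (var)

/-- The number sort of `M` is the non-negative part of a discretely ordered ring. This is a class
so that the algebraic structure of the number sort is found by instance search. -/
class L2Structure.IsDiscretelyOrdered (M : L2Structure.{u}) : Prop where
  holds_of_mem : ∀ φ ∈ basicAxioms, M.Holds φ

namespace L2Structure

variable {M : L2Structure.{u}}

instance : Zero M.carrier := ⟨M.zero⟩
instance : One M.carrier := ⟨M.one⟩
instance : Add M.carrier := ⟨M.add⟩
instance : Mul M.carrier := ⟨M.mul⟩
instance : LE M.carrier := ⟨M.le⟩

/-- The assignment `0 ↦ a`, `1 ↦ b`, `n ↦ c` for `n ≥ 2`. -/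
def assign (a b c : M.carrier) : ℕ → M.carrier
  | 0 => a
  | 1 => b
  | _ => c

variable [hM : M.IsDiscretelyOrdered]

theorem realize_assign {φ : Formula} (hφ : φ ∈ basicAxioms) (a b c : M.carrier) :
    M.Realize φ (assign a b c) (fun _ => ⟨_, M.sets_nonempty.some_mem⟩) :=
  hM.holds_of_mem φ hφ _ _

instance : CommSemiring M.carrier :=
  have add_comm (a b : M.carrier) : a + b = b + a :=
    realize_assign (φ := var 0 + var 1 ≐ var 1 + var 0) (by simp [basicAxioms]) a b b
  have mul_comm (a b : M.carrier) : a * b = b * a :=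
    realize_assign (φ := var 0 * var 1 ≐ var 1 * var 0) (by simp [basicAxioms]) a b b
  have add_zero (a : M.carrier) : a + 0 = a :=
    realize_assign (φ := var 0 + 0 ≐ var 0) (by simp [basicAxioms]) a a a
  have mul_zero (a : M.carrier) : a * 0 = 0 :=
    realize_assign (φ := var 0 * 0 ≐ 0) (by simp [basicAxioms]) a a a
  have mul_one (a : M.carrier) : a * 1 = a :=
    realize_assign (φ := var 0 * 1 ≐ var 0) (by simp [basicAxioms]) a a a
  have mul_add (a b c : M.carrier) : a * (b + c) = a * b + a * c :=
    realize_assign (φ := var 0 * (var 1 + var 2) ≐ var 0 * var 1 + var 0 * var 2)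
      (by simp [basicAxioms]) a b c
  { add_assoc := realize_assign (φ := (var 0 + var 1) + var 2 ≐ var 0 + (var 1 + var 2))
      (by simp [basicAxioms])
    add_comm := add_comm
    add_zero := add_zero
    zero_add := fun a => by rw [add_comm, add_zero]
    nsmul := nsmulRec
    mul_assoc := realize_assign (φ := (var 0 * var 1) * var 2 ≐ var 0 * (var 1 * var 2))
      (by simp [basicAxioms])
    mul_comm := mul_comm
    mul_one := mul_one
    one_mul := fun a => by rw [mul_comm, mul_one]
    mul_zero := mul_zero
    zero_mul := fun a => by rw [mul_comm, mul_zero]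
    left_distrib := mul_add
    right_distrib := fun a b c => by rw [mul_comm, mul_add, mul_comm c, mul_comm c] }

noncomputable instance : LinearOrder M.carrier where
  le_refl a := realize_assign (φ := var 0 ≼ var 0) (by simp [basicAxioms]) a a a
  le_trans a b c hab hbc := realize_assign (φ := var 0 ≼ var 1 ⋏ var 1 ≼ var 2 ⇒' var 0 ≼ var 2)
    (by simp [basicAxioms]) a b c ⟨hab, hbc⟩
  le_antisymm a b hab hba := realize_assign (φ := var 0 ≼ var 1 ⋏ var 1 ≼ var 0 ⇒' var 0 ≐ var 1)
    (by simp [basicAxioms]) a b b ⟨hab, hba⟩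
  le_total a b := realize_assign (φ := var 0 ≼ var 1 ⋎ var 1 ≼ var 0) (by simp [basicAxioms]) a b b
  toDecidableLE := Classical.decRel _

theorem realize_lt {s t : Term} {e : ℕ → M.carrier} {E : ℕ → M.sets} :
    M.Realize (s ≺ t) e E ↔ M.eval e s < M.eval e t :=
  (lt_iff_le_and_ne (a := M.eval e s)).symm

theorem add_lt_add_of_lt {a b : M.carrier} (c : M.carrier) (hab : a < b) : a + c < b + c :=
  realize_lt.1 <| realize_assign (φ := var 0 ≺ var 1 ⇒' var 0 + var 2 ≺ var 1 + var 2)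
    (by simp [basicAxioms]) a b c (realize_lt.2 hab)

theorem mul_lt_mul_of_lt_of_pos {a b c : M.carrier} (hc : 0 < c) (hab : a < b) : a * c < b * c :=
  realize_lt.1 <| realize_assign (φ := 0 ≺ var 2 ⋏ var 0 ≺ var 1 ⇒' var 0 * var 2 ≺ var 1 * var 2)
    (by simp [basicAxioms]) a b c ⟨realize_lt.2 hc, realize_lt.2 hab⟩

theorem zero_lt_one' : (0 : M.carrier) < 1 :=
  realize_lt.1 (realize_assign (φ := 0 ≺ 1) (by simp [basicAxioms]) 0 0 0)

instance : IsOrderedCancelAddMonoid M.carrier where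
  add_le_add_left a b hab c := hab.lt_or_eq.elim (fun h => (add_lt_add_of_lt c h).le) (· ▸ le_rfl)
  le_of_add_le_add_left a b c habc := by
    rw [add_comm a, add_comm a] at habc
    exact le_of_not_gt fun hcb => (add_lt_add_of_lt a hcb).not_ge habc

instance : IsStrictOrderedRing M.carrier where
  zero_le_one := zero_lt_one'.le
  exists_pair_ne := ⟨0, 1, zero_lt_one'.ne⟩
  mul_lt_mul_of_pos_left a ha b c hbc := by
    simpa only [mul_comm a] using mul_lt_mul_of_lt_of_pos ha hbc
  mul_lt_mul_of_pos_right _ ha _ _ hbc := mul_lt_mul_of_lt_of_pos ha hbc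

instance : CanonicallyOrderedAdd M.carrier :=
  have zero_le (a : M.carrier) : 0 ≤ a :=
    realize_assign (φ := 0 ≼ var 0) (by simp [basicAxioms]) a a a
  { exists_add_of_le := fun {a b} hab => by
      obtain ⟨c, hc⟩ := realize_assign (φ := var 0 ≼ var 1 ⇒' .ex 2 (var 0 + var 2 ≐ var 1))
        (by simp [basicAxioms]) a b b hab
      exact ⟨c, hc.symm⟩
    le_add_self := fun _ b => le_add_of_nonneg_left (zero_le b)
    le_self_add := fun _ b => le_add_of_nonneg_right (zero_le b) }

noncomputable instance : SuccAddOrder M.carrier where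
  succ x := x + 1
  le_succ x := le_self_add
  max_of_succ_le {x} hx := absurd hx (lt_add_one x).not_ge
  succ_le_of_lt {x y} hxy := by
    obtain ⟨z, rfl⟩ := exists_add_of_le hxy.le
    have one_le : 1 ≤ z := realize_assign (φ := 0 ≺ var 0 ⇒' 1 ≼ var 0) (by simp [basicAxioms])
      z z z (realize_lt.2 (pos_of_lt_add_right hxy))
    gcongr
  succ_eq_add_one _ := rfl

end L2Structure

end NumberSort

section Representation

variable {M : L2Structure.{u}}

theorem L2Structure.realize_update_set {X : ℕ} (A : M.sets) {φ : Formula} (hX : X ∉ φ.setVars)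
    (e : ℕ → M.carrier) (E : ℕ → M.sets) :
    M.Realize φ e (Function.update E X A) ↔ M.Realize φ e E := by
  induction φ generalizing e E with
  | eq | le => rfl
  | mem t Y =>
    rw [Formula.setVars, Finset.mem_singleton] at hX
    simp only [L2Structure.Realize, Function.update_of_ne (Ne.symm hX)]
  | neg φ ih => exact not_congr (ih hX e E)
  | and φ ψ ihφ ihψ | or φ ψ ihφ ihψ | imp φ ψ ihφ ihψ =>
    rw [Formula.setVars, Finset.notMem_union] at hX
    simp only [L2Structure.Realize, ihφ hX.1, ihψ hX.2]
  | all x φ ih | ex x φ ih => simp only [L2Structure.Realize, ih hX]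
  | allS Y φ ih | exS Y φ ih =>
    rw [Formula.setVars, Finset.mem_insert, not_or] at hX
    simp only [L2Structure.Realize, Function.update_comm hX.1, ih hX.2]

/-- The filter of enumerations whose range contains any prescribed finitely many elements. -/
def enumerating (α : Type u) : Filter (ℕ → α) := ⨅ a, .principal {κ | a ∈ Set.range κ}

theorem eventually_mem_range {α : Type u} (a : α) : ∀ᶠ κ in enumerating α, a ∈ Set.range κ :=
  Filter.mem_iInf_of_mem a (Filter.mem_principal_self _)

instance {α : Type u} [Nonempty α] : (enumerating α).NeBot := by
  refine (Filter.hasBasis_iInf_principal_finite _).neBot_iff.2 fun {A} hA => ?_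
  obtain ⟨κ, hκ⟩ := Set.countable_iff_exists_subset_range.1 hA.countable
  exact ⟨κ, Set.mem_iInter₂.2 fun _ ha => hκ ha⟩

/-- The assignment `e` gives the odd variables the values listed by `κ`. -/
def ReadsParams {α : Type u} (κ e : ℕ → α) : Prop := ∀ k, e (2 * k + 1) = κ k

theorem readsParams_half {α : Type u} (κ : ℕ → α) : ReadsParams κ fun k => κ (k / 2) :=
  fun k => congrArg κ (by lia)

theorem ReadsParams.update {α : Type u} {κ e : ℕ → α} (he : ReadsParams κ e) (n : ℕ) (a : α) :
    ReadsParams κ (Function.update e (2 * n) a) := fun k => by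
  rw [Function.update_of_ne (by lia), he k]

theorem update_two_mul_apply {α : Type u} (e : ℕ → α) {n : ℕ} (a : α) (i : Fin n) :
    Function.update e (2 * n) a (2 * (i : ℕ)) = e (2 * (i : ℕ)) :=
  Function.update_of_ne (by simpa using i.isLt.ne) _ _

/-- The term `t` represents the function `f`: the arguments of `f` are read from the even
variables, and the odd variables are number parameters listed by `κ`. -/
def Term.Represents (κ : ℕ → M.carrier) (t : Term) {n : ℕ}
    (f : (Fin n → M.carrier) → M.carrier) : Prop :=
  ∀ e, ReadsParams κ e → M.eval e t = f fun i => e (2 * i)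

/-- The formula `φ` represents the relation `P`: the arguments of `P` are read from the even
variables, the odd variables are number parameters listed by `κ`, and the set variables are set
parameters listed by `E`. -/
def Formula.Represents (κ : ℕ → M.carrier) (E : ℕ → M.sets) (φ : Formula) {n : ℕ}
    (P : (Fin n → M.carrier) → Prop) : Prop :=
  ∀ e, ReadsParams κ e → (M.Realize φ e E ↔ P fun i => e (2 * i))

variable {κ : ℕ → M.carrier} {E : ℕ → M.sets} {n : ℕ} {φ : Formula}

theorem Formula.Represents.realize_update {P : M.carrier → Prop}
    (h : φ.Represents κ E fun v : Fin 1 → M.carrier => P (v 0)) {e : ℕ → M.carrier}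
    (he : ReadsParams κ e) (a : M.carrier) : M.Realize φ (Function.update e 0 a) E ↔ P a := by
  simpa using h _ (he.update 0 a)

theorem Formula.Represents.all {P : (Fin n → M.carrier) → M.carrier → Prop}
    (h : φ.Represents κ E fun w : Fin (n + 1) → M.carrier =>
      P (fun i => w i.castSucc) (w (Fin.last n))) :
    (Formula.all (2 * n) φ).Represents κ E fun v => ∀ a, P v a := fun e he =>
  forall_congr' fun a => by simpa [update_two_mul_apply] using h _ (he.update n a)

theorem Formula.Represents.ex {P : (Fin n → M.carrier) → M.carrier → Prop}
    (h : φ.Represents κ E fun w : Fin (n + 1) → M.carrier =>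
      P (fun i => w i.castSucc) (w (Fin.last n))) :
    (Formula.ex (2 * n) φ).Represents κ E fun v => ∃ a, P v a := fun e he =>
  exists_congr fun a => by simpa [update_two_mul_apply] using h _ (he.update n a)

theorem Term.Represents.realize_var_le {t : Term} {f : (Fin n → M.carrier) → M.carrier}
    (ht : t.Represents κ f) {e : ℕ → M.carrier} (he : ReadsParams κ e) :
    M.Realize (.var (2 * n) ≼ t) e E ↔ e (2 * n) ≤ f fun i => e (2 * i) := by
  rw [← ht e he]
  rfl

theorem PolyFun.eventually_exists_represents {f : (Fin n → M.carrier) → M.carrier}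
    (hf : PolyFun f) :
    ∀ᶠ κ in enumerating M.carrier, ∃ t : Term, 2 * n ∉ t.vars ∧ t.Represents κ f := by
  induction hf with
  | var i =>
    exact .of_forall fun κ => ⟨.var (2 * i), by simpa [Term.vars] using i.isLt.ne', fun e _ => rfl⟩
  | const c =>
    filter_upwards [eventually_mem_range c] with κ ⟨k, hk⟩
    refine ⟨.var (2 * k + 1), ?_, fun e he => (he k).trans hk⟩
    rw [Term.vars, Finset.mem_singleton]
    lia
  | add _ _ ihf ihg =>
    filter_upwards [ihf, ihg] with κ ⟨s, hsn, hs⟩ ⟨t, htn, ht⟩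
    exact ⟨.add s t, Finset.notMem_union.2 ⟨hsn, htn⟩,
      fun e he => congrArg₂ (· + ·) (hs e he) (ht e he)⟩
  | mul _ _ ihf ihg =>
    filter_upwards [ihf, ihg] with κ ⟨s, hsn, hs⟩ ⟨t, htn, ht⟩
    exact ⟨.mul s t, Finset.notMem_union.2 ⟨hsn, htn⟩,
      fun e he => congrArg₂ (· * ·) (hs e he) (ht e he)⟩

variable {P : (Fin n → M.carrier) → Prop}

theorem Delta0Rel.eventually_exists_represents (hP : Delta0Rel M.sets P) :
    ∀ᶠ p : (ℕ → M.carrier) × (ℕ → M.sets) in enumerating _ ×ˢ enumerating _,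
      ∃ φ, IsDelta0 φ ∧ φ.Represents p.1 p.2 P := by
  induction hP with
  | eq hf hg =>
    filter_upwards [hf.eventually_exists_represents.prod_inl _,
      hg.eventually_exists_represents.prod_inl _] with p ⟨s, _, hs⟩ ⟨t, _, ht⟩
    exact ⟨s ≐ t, .eq s t, fun e he => by simp only [L2Structure.Realize, hs e he, ht e he]⟩
  | le hf hg =>
    filter_upwards [hf.eventually_exists_represents.prod_inl _,
      hg.eventually_exists_represents.prod_inl _] with p ⟨s, _, hs⟩ ⟨t, _, ht⟩
    exact ⟨s ≼ t, .le s t, fun e he => by simp only [L2Structure.Realize, hs e he, ht e he]; rfl⟩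
  | mem X hf =>
    filter_upwards [hf.eventually_exists_represents.prod_mk (eventually_mem_range X)]
      with p ⟨⟨t, _, ht⟩, k, hk⟩
    exact ⟨t ∈' k, .mem t k, fun e he => by simp only [L2Structure.Realize, ht e he, hk]⟩
  | not _ ih =>
    filter_upwards [ih] with p ⟨φ, hφ, h⟩
    exact ⟨.neg φ, .neg hφ, fun e he => not_congr (h e he)⟩
  | and _ _ ihP ihQ =>
    filter_upwards [ihP, ihQ] with p ⟨φ, hφ, h⟩ ⟨ψ, hψ, h'⟩
    exact ⟨φ ⋏ ψ, .and hφ hψ, fun e he => and_congr (h e he) (h' e he)⟩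
  | or _ _ ihP ihQ =>
    filter_upwards [ihP, ihQ] with p ⟨φ, hφ, h⟩ ⟨ψ, hψ, h'⟩
    exact ⟨φ ⋎ ψ, .or hφ hψ, fun e he => or_congr (h e he) (h' e he)⟩
  | imp _ _ ihP ihQ =>
    filter_upwards [ihP, ihQ] with p ⟨φ, hφ, h⟩ ⟨ψ, hψ, h'⟩
    exact ⟨φ ⇒' ψ, .imp hφ hψ, fun e he => imp_congr (h e he) (h' e he)⟩
  | @ball n f P hf _ ih =>
    filter_upwards [hf.eventually_exists_represents.prod_inl _, ih] with p ⟨t, htn, ht⟩ ⟨φ, hφ, h⟩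
    exact ⟨_, .ball htn hφ, .all (P := fun v a => a ≤ f v → P v a) fun e he =>
      imp_congr (ht.realize_var_le he) (h e he)⟩
  | @bex n f P hf _ ih =>
    filter_upwards [hf.eventually_exists_represents.prod_inl _, ih] with p ⟨t, htn, ht⟩ ⟨φ, hφ, h⟩
    exact ⟨_, .bex htn hφ, .ex (P := fun v a => a ≤ f v ∧ P v a) fun e he =>
      and_congr (ht.realize_var_le he) (h e he)⟩

theorem Sigma1Rel.eventually_exists_represents (hP : Sigma1Rel M.sets P) :
    ∀ᶠ p : (ℕ → M.carrier) × (ℕ → M.sets) in enumerating _ ×ˢ enumerating _,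
      ∃ φ, IsSigma 1 φ ∧ φ.Represents p.1 p.2 P := by
  induction hP with
  | delta0 hP =>
    filter_upwards [hP.eventually_exists_represents] with p ⟨φ, hφ, h⟩
    exact ⟨φ, .of_pi (.delta0 hφ), h⟩
  | ex _ ih =>
    filter_upwards [ih] with p ⟨φ, hφ, h⟩
    exact ⟨_, .ex _ hφ, h.ex⟩

theorem Pi1Rel.eventually_exists_represents (hP : Pi1Rel M.sets P) :
    ∀ᶠ p : (ℕ → M.carrier) × (ℕ → M.sets) in enumerating _ ×ˢ enumerating _,
      ∃ φ, IsPi 1 φ ∧ φ.Represents p.1 p.2 P := by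
  induction hP with
  | delta0 hP =>
    filter_upwards [hP.eventually_exists_represents] with p ⟨φ, hφ, h⟩
    exact ⟨φ, .of_sigma (.delta0 hφ), h⟩
  | all _ ih =>
    filter_upwards [ih] with p ⟨φ, hφ, h⟩
    exact ⟨_, .all _ hφ, h.all⟩

theorem Sigma2Rel.eventually_exists_represents (hP : Sigma2Rel M.sets P) :
    ∀ᶠ p : (ℕ → M.carrier) × (ℕ → M.sets) in enumerating _ ×ˢ enumerating _,
      ∃ φ, IsSigma 2 φ ∧ φ.Represents p.1 p.2 P := by
  induction hP with
  | pi1 hP =>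
    filter_upwards [hP.eventually_exists_represents] with p ⟨φ, hφ, h⟩
    exact ⟨φ, .of_pi hφ, h⟩
  | ex _ ih =>
    filter_upwards [ih] with p ⟨φ, hφ, h⟩
    exact ⟨_, .ex _ hφ, h.ex⟩

end Representation

section Soundness

variable {M : L2Structure.{u}}

theorem L2Structure.exists_set_of_delta1Comprehension (hM : ∀ θ ∈ delta1Comprehension, M.Holds θ)
    {P Q : M.carrier → Prop} (hP : Sigma1Rel M.sets fun v : Fin 1 → M.carrier => P (v 0))
    (hQ : Sigma1Rel M.sets fun v : Fin 1 → M.carrier => Q (v 0)) (h : ∀ x, P x ↔ ¬ Q x) :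
    ∃ X : M.sets, ∀ x, x ∈ (X : Set M.carrier) ↔ P x := by
  have : Nonempty M.carrier := ⟨M.zero⟩
  have : Nonempty M.sets := M.sets_nonempty.to_subtype
  obtain ⟨⟨κ, E⟩, ⟨φ, hφ, hφP⟩, ψ, hψ, hψQ⟩ :=
    (hP.eventually_exists_represents.and hQ.eventually_exists_represents).exists
  obtain ⟨Y, hY⟩ := Infinite.exists_notMem_finset φ.setVars
  have he := readsParams_half κ
  obtain ⟨X, hX⟩ := hM _ ⟨φ, ψ, 0, Y, hφ, hψ, hY, rfl⟩ (fun k => κ (k / 2)) E fun x =>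
    iff_iff_implies_and_implies.1 <| (hφP.realize_update he x).trans <|
      (h x).trans (hψQ.realize_update he x).not.symm
  refine ⟨X, fun x => ?_⟩
  rw [← hφP.realize_update he x, ← realize_update_set X hY]
  simpa [L2Structure.Realize, L2Structure.eval] using iff_iff_implies_and_implies.2 (hX x)

theorem L2Structure.induction_of_sigmaInd {n : ℕ} (hM : ∀ θ ∈ sigmaInd n, M.Holds θ)
    {P : M.carrier → Prop}
    (hP : ∀ᶠ p : (ℕ → M.carrier) × (ℕ → M.sets) in enumerating _ ×ˢ enumerating _,
      ∃ φ, IsSigma n φ ∧ φ.Represents p.1 p.2 fun v : Fin 1 → M.carrier => P (v 0))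
    (zero : P 0) (succ : ∀ x, P x → P (x + 1)) (x : M.carrier) : P x := by
  have : Nonempty M.carrier := ⟨M.zero⟩
  have : Nonempty M.sets := M.sets_nonempty.to_subtype
  obtain ⟨⟨κ, E⟩, φ, hφ, h⟩ := hP.exists
  obtain ⟨y, hy⟩ := Infinite.exists_notMem_finset <|
    (insert 0 φ.numVars).preimage (2 * ·) (mul_right_injective₀ two_ne_zero).injOn
  obtain ⟨hy0, hyφ⟩ : 2 * y ≠ 0 ∧ 2 * y ∉ φ.numVars := by simpa using hy
  have he := readsParams_half κ
  refine (h.realize_update he x).1 <|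
    hM _ ⟨φ, 0, 2 * y, hφ, hy0, hyφ, rfl⟩ _ E ⟨fun a ha => ?_, fun a ha b hb c hc => ?_⟩ x
  · obtain rfl : a = 0 :=
      show a = M.zero by simpa [L2Structure.Realize, L2Structure.eval] using ha
    exact (h.realize_update he _).2 zero
  · obtain rfl : c = b := by simpa [L2Structure.Realize, L2Structure.eval, hy0] using hc
    obtain rfl : c = a + 1 := show c = M.add a M.one by
      simpa [L2Structure.Realize, L2Structure.eval, hy0.symm] using hb
    exact (h.realize_update ((he.update 0 a).update y _) _).2 <|
      succ a ((h.realize_update he a).1 ha)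

variable [M.IsDiscretelyOrdered]

theorem L2Structure.modelsSigma2Ind (hM : ∀ θ ∈ RCA0 ∪ sigmaInd 2, M.Holds θ) :
    ModelsSigma2Ind M.sets where
  comprehension _ _ hP hQ :=
    exists_set_of_delta1Comprehension (fun θ hθ => hM θ (.inl (.inl (.inr hθ)))) hP hQ
  induction _ hP :=
    induction_of_sigmaInd (fun θ hθ => hM θ (.inl (.inr hθ))) hP.eventually_exists_represents
  sigma2_induction _ hP :=
    induction_of_sigmaInd (fun θ hθ => hM θ (.inr hθ)) hP.eventually_exists_represents

end Soundness

section Sentence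

namespace L2Structure

variable {M : L2Structure.{u}} [M.IsDiscretelyOrdered] {e : ℕ → M.carrier} {E : ℕ → M.sets}

theorem le_of_realize_levelGraph {Q V D : ℕ} {b r i : M.carrier}
    (hb : ∀ q ∈ (E Q : Set M.carrier), q ≤ b) (h : M.Realize (levelGraph Q V D) e E)
    (hr : ⟪r, i⟫ ∈ (E V : Set M.carrier)) : r ≤ b := by
  obtain ⟨q, j, hq, heq⟩ := h.1 _ hr
  exact (pairCode_inj.1 heq).1 ▸ hb q hq

theorem isLevelGraph_of_realize {Q V D : ℕ} {b : M.carrier}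
    (hb : ∀ q ∈ (E Q : Set M.carrier), q ≤ b) (h : M.Realize (levelGraph Q V D) e E) :
    IsLevelGraph b (E D : Set M.carrier) := by
  intro z hz
  obtain ⟨r, r', i, hr, hr', heq⟩ := h.2 z hz
  exact ⟨r, le_of_realize_levelGraph hb h hr, r', le_of_realize_levelGraph hb h hr', i, heq⟩

theorem exists_isCodedPath_of_realize {V D : ℕ} (h : M.Realize (longPaths V D) e E)
    (n : M.carrier) : ⟪e 0, 0⟫ ∈ (E V : Set M.carrier) ∧ ∃ m, n ≤ m ∧ ∃ c d,
      IsEntry c d 0 ⟪e 0, 0⟫ ∧ IsCodedPath (E D : Set M.carrier) m c d := by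
  obtain ⟨m, c, d, hn, hq, ⟨hlt, hc⟩, hpath⟩ := h n
  refine ⟨hq, m, hn, c, d, isEntry_iff.2 ⟨realize_lt.1 hlt, hc⟩, fun j hj => ?_⟩
  obtain ⟨v, w, ⟨hv, hcv⟩, ⟨hw, hcw⟩, hvw⟩ := hpath j (realize_lt.2 hj)
  exact ⟨v, w, isEntry_iff.2 ⟨realize_lt.1 hv, hcv⟩, isEntry_iff.2 ⟨realize_lt.1 hw, hcw⟩, hvw⟩

theorem realize_infinitePath {D P : ℕ} {f : M.carrier → M.carrier}
    (hP : IsGraph (E P : Set M.carrier) f) (zero : f 0 = ⟪e 0, 0⟫)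
    (edge : ∀ x, ⟪f x, f (x + 1)⟫ ∈ (E D : Set M.carrier)) : M.Realize (infinitePath D P) e E := by
  refine ⟨⟨fun z hz => ?_, fun x => ⟨f x, hP.pairCode_mem_iff.2 rfl⟩, fun x v w h => ?_⟩, ?_, ?_⟩
  · obtain ⟨x, hx⟩ := (hP z).1 hz
    exact ⟨x, f x, hx⟩
  · exact (hP.pairCode_mem_iff.1 h.1).trans (hP.pairCode_mem_iff.1 h.2).symm
  · exact hP.pairCode_mem_iff.2 zero.symm
  · rintro x v w ⟨hv, hw⟩
    obtain rfl : v = f x := hP.pairCode_mem_iff.1 hv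
    obtain rfl : w = f (x + 1) := hP.pairCode_mem_iff.1 hw
    exact edge x

end L2Structure

end Sentence
end SOA

theorem mainTheorem2 :
    SOA.Entails.{u} (SOA.RCA0 ∪ SOA.sigmaInd 2) SOA.boundedWidthKonig := by
  intro M hM
  have : M.IsDiscretelyOrdered := ⟨fun θ hθ => hM θ (.inl (.inl (.inl hθ)))⟩
  rintro e E Q V D ⟨⟨b, hb⟩, hgraph⟩ q hlong
  have hE := SOA.L2Structure.isLevelGraph_of_realize hb hgraph
  have hlong := SOA.L2Structure.exists_isCodedPath_of_realize hlong
  have hq : q ≤ b := SOA.L2Structure.le_of_realize_levelGraph hb hgraph (hlong 0).1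
  obtain ⟨P, f, hP, zero, edge⟩ := (SOA.L2Structure.modelsSigma2Ind hM).exists_infinite_path hE hq
    fun n => (hlong n).2
  exact ⟨P, SOA.L2Structure.realize_infinitePath hP zero edge⟩
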